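/- Consider a finite set $\mathcal F$ of fog nodes, finite type sets $\mathcal Y_j$ and arbitrary non-empty action sets $\mathcal A_j$ ($j\in\mathcal F$), and finite sets $\mathcal U$ of physical states, $\Omega$ of observations and $Z$ of end-of-slot outcomes. If the physical state of a slot is $u$ and the action profile is $\boldsymbol a$, the next physical state has a given law $T(\cdot,\boldsymbol a,u)$, and node $i$ receives the reward $\varpi_i(u,\boldsymbol a)$. At the end of the slot node $i$ learns $\varphi_i(u)\in Z$ ($\varphi_i$ given; injective if physical states are disclosed at the end of the slot, constant if they are not). At the beginning of the next slot, in physical state $u'$, it receives an observation drawn from $\Theta_i(\cdot,a_i,u')$. Fix a node $i$ with bounded reward. The types $\boldsymbol y_{-i}$ of the other nodes are unknown to $i$ and constant in time; in physical state $u$ the other nodes jointly draw their actions (afresh in each slot) from a given discrete law $\sigma_i(\cdot\mid \boldsymbol y_{-i},u)$. Let $T'_i(u',a,u,\boldsymbol y_{-i})$ be the resulting probability of moving from $u$ to $u'$ and $\bar\varpi_i(u,a,\boldsymbol y_{-i})$ the resulting expected reward when $i$ plays $a$. Let $0\le\gamma<1$. (1) Let $u_0$ be an initial physical state, let $b''_0$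 be a prior on the types $\boldsymbol y_{-i}$, let the true types $\boldsymbol y^*_{-i}$ have positive prior probability, and let node $i$ choose its actions by any (randomized, history-dependent) rule. Along the realized physical states $u_t$ and own actions $a_t$, let the belief about types be updated by Bayes' rule $$b''_{t+1}(\boldsymbol y_{-i})=\frac{T'_i(u_{t+1},a_t,u_t,\boldsymbol y_{-i})\,b''_t(\boldsymbol y_{-i})}{\sum_{\boldsymbol y'_{-i}}T'_i(u_{t+1},a_t,u_t,\boldsymbol y'_{-i})\,b''_t(\boldsymbol y'_{-i})}.$$ Then, almost surely, $b''_t$ converges to a probability distribution $b''_\infty$, which is stationary: the Bayes update of $b''_\infty$ by the transition $(u_t,a_t,u_{t+1})$ tends to $b''_\infty$ as $t\to\infty$, and it equals $b''_\infty$ for each transition that occurs infinitely often. (2) Let $b$ denote beliefs of $i$ about the pair $(u,\boldsymbol y_{-i})$, written $b(u,\boldsymbol y_{-i})=b'(u)\,b''(\boldsymbol y_{-i}\mid u)$ and updated by Bayes' rule to $B(b,a,z,o)$ after own action $a$, outcome $z$ and next observation $o$. If $z=\varphi_i(u)$ discloses the past state $u$, then the type component of $B(b,a,z,o)$ under each state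 $u'$ of positive probability is obtained from $b''(\cdot\mid u)$ by the rule in (1), applied to the transition $(u,a,u')$. The Bellman equation $\upsilon(b)=\sup_{a}\bar\varpi'_i(b,a)$ with $$\bar\varpi'_i(b,a)=\sum_{u,\boldsymbol y_{-i}}b'(u)\,b''(\boldsymbol y_{-i}\mid u)\,\bar\varpi_i(u,a,\boldsymbol y_{-i})+\gamma\sum_{z,o}\Pr(z,o\mid b,a)\,\upsilon\big(B(b,a,z,o)\big)$$ has exactly one bounded solution $\upsilon$ on the set of beliefs. Every policy that takes, at each belief $b$, an action maximizing $\bar\varpi'_i(b,\cdot)$ (such a policy exists if $\mathcal A_i$ is finite) is optimal from every initial belief state $b_0$: if the initial physical state and the types are distributed according to $b_0$, its expected discounted reward $\sum_t\gamma^t\,\mathbb E[\varpi_{i,t}]$ equals $\upsilon(b_0)$ and is at least that of every history-dependent, possibly randomized (with discrete laws) policy based on what node $i$ has seen. -/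

import Mathlib

open Filter Topology MeasureTheory

noncomputable section

/-- Expectation of a real function under a discrete probability distribution. -/
def expect {α : Type*} (p : PMF α) (f : α → ℝ) : ℝ := ∑' x, (p x).toReal * f x

/-- The energy scheduling game with set of fog nodes `F`.  `Y j` is the type space and `A j` the
action set of node `j`, `U` the set of physical states, `O` the set of observations, and `Z` the
set of end-of-slot outcomes. -/
structure FogGame (F : Type*) (Y A : F → Type*) (U O Z : Type*) where
  /-- law of the next physical state, given the present one and the action profile -/
  transition : U → (∀ j, A j) → PMF U
  /-- law of the observation of node `i` at the beginning of a slot, given its previous action and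
  the new physical state -/
  observation : ∀ i : F, A i → U → PMF O
  /-- reward of node `i` in a slot with the given physical state and action profile -/
  reward : F → U → (∀ j, A j) → ℝ
  /-- what node `i` learns, at the end of a slot, about the physical state of this slot: nothing if
  the map is constant, the state itself if the map is injective -/
  outcome : F → U → Z
  /-- how the types of the nodes other than `i` determine the (joint) random decision of these
  nodes in a physical state -/
  decision : ∀ i : F, (∀ j : {j : F // j ≠ i}, Y j.1) → U → PMF (∀ j : {j : F // j ≠ i}, A j.1)

/-- The profiles of types of the nodes other than `i`. -/
abbrev OtherTypes {F : Type*} (Y : F → Type*) (i : F) : Type _ := ∀ j : {j : F // j ≠ i}, Y j.1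

namespace FogGame

variable {F : Type*} [DecidableEq F] {Y A : F → Type*} {U O Z : Type*}

/-- The action profile with action `a` of node `i` and actions `a'` of the others. -/
def profile (i : F) (a : A i) (a' : ∀ j : {j : F // j ≠ i}, A j.1) : ∀ j, A j :=
  (Equiv.piSplitAt i A).symm (a, a')

/-- Transition dynamics `T'ᵢ` of the B-POMDP of node `i`: law of the next physical state when node
`i` takes action `a` in the physical state `u` and the others, whose types are `y`, decide
according to their types. -/
def stateKernel (G : FogGame F Y A U O Z) (i : F) (y : OtherTypes Y i) (u : U) (a : A i) : PMF U :=
  (G.decision i y u).bind fun a' => G.transition u (profile i a a')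

/-- Expected reward of node `i` in one slot, given the physical state and the types of the
others. -/
def slotReward (G : FogGame F Y A U O Z) (i : F) (y : OtherTypes Y i) (u : U) (a : A i) : ℝ :=
  expect (G.decision i y u) fun a' => G.reward i u (profile i a a')

/-! ### Bayesian update of the belief about types -/

section TypeBelief

variable [Fintype F] [∀ j, Fintype (Y j)]

/-- Bayes' rule for the belief `b` about the types of the other nodes, after the transition of the
physical state from `u` to `u'` under own action `a`:
`b⁺ y = β' * T'ᵢ (u', a, u, y) * b y` with a normalizing factor `β'`. -/
def typeBeliefUpdate (G : FogGame F Y A U O Z) (i : F) (b : OtherTypes Y i → ℝ)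
    (u : U) (a : A i) (u' : U) : OtherTypes Y i → ℝ := fun y =>
  (G.stateKernel i y u a u').toReal * b y / ∑ y', (G.stateKernel i y' u a u').toReal * b y'

/-- The successive beliefs about types, started from `b`, along a path of physical states `u` and
own actions `a`. -/
def typeBeliefSeq (G : FogGame F Y A U O Z) (i : F) (b : OtherTypes Y i → ℝ)
    (u : ℕ → U) (a : ℕ → A i) : ℕ → OtherTypes Y i → ℝ
  | 0 => b
  | t + 1 => G.typeBeliefUpdate i (typeBeliefSeq G i b u a t) (u t) (a t) (u (t + 1))

end TypeBelief

/-! ### Law of the process -/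

/-- A rule by which the action of node `i` is drawn in each slot from the past (a list with the
most recent slot first; the entry of slot `s` is the physical state and own action in slot `s` and
the observation at the beginning of slot `s + 1`) and the present physical state.  It is not
restricted to the information that node `i` really has. -/
abbrev Behaviour (A : F → Type*) (U O : Type*) (i : F) : Type _ := List (U × A i × O) → U → PMF (A i)

/-- Law of (present physical state, types of the others, past) at the beginning of slot `t`, when
the initial physical state and the types of the others have joint law `init` and node `i` acts
according to `β`. -/
def runLaw (G : FogGame F Y A U O Z) (i : F) (β : Behaviour A U O i)
    (init : PMF (U × OtherTypes Y i)) : ℕ → PMF ((U × OtherTypes Y i) × List (U × A i × O))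
  | 0 => init.map fun s => (s, [])
  | t + 1 => (runLaw G i β init t).bind fun r =>
      (β r.2 r.1.1).bind fun a =>
        (G.stateKernel i r.1.2 r.1.1 a).bind fun u' =>
          (G.observation i a u').map fun o => ((u', r.1.2), (r.1.1, a, o) :: r.2)

/-- The past at the beginning of slot `t` along a path. -/
def past {i : F} (u : ℕ → U) (a : ℕ → A i) (o : ℕ → O) : ℕ → List (U × A i × O)
  | 0 => []
  | t + 1 => (u t, a t, o (t + 1)) :: past u a o t

/-- On the probability space `(S, P)`, the sequences `u`, `a`, `o` of physical states, actions and
observations of node `i` form a run of the game from the physical state `u₀`, when the true types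
of the others are `y` and node `i` acts according to `β`. -/
structure IsRun (G : FogGame F Y A U O Z) (i : F) (β : Behaviour A U O i) (u₀ : U)
    (y : OtherTypes Y i) {S : Type*} [mS : MeasurableSpace S] (P : Measure S)
    (u : ℕ → S → U) (a : ℕ → S → A i) (o : ℕ → S → O) : Prop where
  measurable_state : ∀ t, Measurable[mS, ⊤] (u t)
  measurable_action : ∀ t, Measurable[mS, ⊤] (a t)
  measurable_obs : ∀ t, Measurable[mS, ⊤] (o t)
  law : ∀ t w h,
    P {ω | u t ω = w ∧ past (fun s => u s ω) (fun s => a s ω) (fun s => o s ω) t = h} =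
      G.runLaw i β (PMF.pure (u₀, y)) t ((w, y), h)

/-- A policy of node `i`: its action is drawn on the basis of what it has seen, that is, of the
past slots (most recent first), each with the end-of-slot outcome, the own action, and the
observation at the beginning of the next slot. -/
abbrev Policy (A : F → Type*) (O Z : Type*) (i : F) : Type _ := List (Z × A i × O) → PMF (A i)

/-- The behaviour of a node that follows a policy. -/
def Policy.behaviour {i : F} (G : FogGame F Y A U O Z) (π : Policy A O Z i) : Behaviour A U O i :=
  fun h _ => π (h.map fun e => (G.outcome i e.1, e.2.1, e.2.2))

/-- Expected reward of node `i` in slot `t` under a policy, when the initial physical state and the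
types of the others have joint law `init`. -/
def meanReward (G : FogGame F Y A U O Z) (i : F) (π : Policy A O Z i)
    (init : PMF (U × OtherTypes Y i)) (t : ℕ) : ℝ :=
  expect
    ((G.runLaw i (π.behaviour G) init t).bind fun r =>
      (π.behaviour G r.2 r.1.1).bind fun a =>
        (G.decision i r.1.2 r.1.1).map fun a' => (r.1.1, profile i a a'))
    fun x => G.reward i x.1 x.2

/-- Long-term discounted expected reward of node `i`. -/
def longTermReward (G : FogGame F Y A U O Z) (i : F) (γ : ℝ) (π : Policy A O Z i)
    (init : PMF (U × OtherTypes Y i)) : ℝ :=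
  ∑' t : ℕ, γ ^ t * G.meanReward i π init t

/-! ### Belief states and the Bellman equation -/

section Belief

variable [Fintype F] [∀ j, Fintype (Y j)] [Fintype U] [Fintype O] [Fintype Z] {i : F}

/-- The belief `b'` about the physical state contained in a belief about state and types. -/
def stateBelief (b : U × OtherTypes Y i → ℝ) (u : U) : ℝ := ∑ y, b (u, y)

/-- The belief `b''` about the types of the others under the physical state `u`. -/
def typeBelief (b : U × OtherTypes Y i → ℝ) (u : U) (y : OtherTypes Y i) : ℝ :=
  b (u, y) / stateBelief b u

variable (G : FogGame F Y A U O Z)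

open Classical in
/-- Probability, under belief `b` and own action `a`, that the present slot ends with outcome `z`,
the next observation is `o`, the next physical state is `s.1` and the types of the others are
`s.2`. -/
def jointProb (b : U × OtherTypes Y i → ℝ) (a : A i) (z : Z) (o : O)
    (s : U × OtherTypes Y i) : ℝ :=
  (G.observation i a s.1 o).toReal *
    ∑ u, if G.outcome i u = z then (G.stateKernel i s.2 u a s.1).toReal * b (u, s.2) else 0

/-- Probability of outcome `z` and next observation `o` under belief `b` and own action `a`. -/
def signalProb (b : U × OtherTypes Y i → ℝ) (a : A i) (z : Z) (o : O) : ℝ :=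
  ∑ s, G.jointProb b a z o s

/-- Bayesian update of the belief about physical state and types. -/
def beliefUpdate (b : U × OtherTypes Y i → ℝ) (a : A i) (z : Z) (o : O) :
    U × OtherTypes Y i → ℝ := fun s => G.jointProb b a z o s / G.signalProb b a z o

/-- Long-term expected reward of action `a` under belief `b`, when `v` gives the future expected
reward as a function of the future belief. -/
def actionValue (γ : ℝ) (v : (U × OtherTypes Y i → ℝ) → ℝ) (b : U × OtherTypes Y i → ℝ)
    (a : A i) : ℝ :=
  ∑ u, ∑ y, stateBelief b u * typeBelief b u y * G.slotReward i y u a +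
    γ * ∑ z, ∑ o, G.signalProb b a z o * v (G.beliefUpdate b a z o)

/-- `v` is bounded and satisfies the Bellman equation on all beliefs. -/
def IsBellmanSolution (γ : ℝ) (v : (U × OtherTypes Y i → ℝ) → ℝ) : Prop :=
  (∃ C : ℝ, ∀ b ∈ stdSimplex ℝ (U × OtherTypes Y i), |v b| ≤ C) ∧
    ∀ b ∈ stdSimplex ℝ (U × OtherTypes Y i),
      IsLUB (Set.range fun a : A i => G.actionValue γ v b a) (v b)

/-- `d` selects at each belief an action that maximizes the long-term expected reward. -/
def IsMaximizing (γ : ℝ) (v : (U × OtherTypes Y i → ℝ) → ℝ)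
    (d : (U × OtherTypes Y i → ℝ) → A i) : Prop :=
  ∀ b ∈ stdSimplex ℝ (U × OtherTypes Y i), ∀ a : A i,
    G.actionValue γ v b a ≤ G.actionValue γ v b (d b)

/-- The belief after the given past, started from `b`. -/
def beliefAfter (b : U × OtherTypes Y i → ℝ) : List (Z × A i × O) → U × OtherTypes Y i → ℝ
  | [] => b
  | e :: h => G.beliefUpdate (beliefAfter b h) e.2.1 e.1 e.2.2

/-- The policy that starts from the belief `b`, updates it, and always takes the action that `d`
prescribes at the present belief. -/
def beliefPolicy (d : (U × OtherTypes Y i → ℝ) → A i) (b : U × OtherTypes Y i → ℝ) :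
    Policy A O Z i := fun h => PMF.pure (d (G.beliefAfter b h))

end Belief

end FogGame

end

/-! Part (1). The laws of own actions and of observations do not depend on the types, so Bayes' rule
gives `b''_t(y') ∝ b''_0(y') L_t(y')`, where `L_t(y')` is the product along the path of the ratios
`T'(y') / T'(y*)`. Under the true types each `L_t(y')` is a nonnegative supermartingale of mean at
most one, hence converges almost surely (`IsRun.ae_exists_tendsto_runRatio`). Since `L_t(y*) = 1`
and `y*` has positive prior weight, the normalizing sum stays away from zero and the beliefs
converge. Where the limit of `L_t(y')` is positive, the one-step ratio `L_{t+1} / L_t` tends to one;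
where it is zero, the limit belief vanishes. Hence the limit is stationary
(`exists_limit_of_likelihoodRatio`).

Part (2). Signal probabilities sum to one and signals of positive probability lead to beliefs in the
simplex, so the Bellman operator is a `γ`-contraction on bounded functions; this gives existence and
uniqueness. For optimality, the belief after the visible past is the conditional law of state and
types (`expect_runLaw_eq_expect_belief`). Therefore the mean reward of a slot plus `γ` times the
mean of `v` at the next belief is the mean of `actionValue` at the present belief
(`meanReward_add_eq`). This is at most the mean of `v`, with equality for a maximizing policy, and
the discounted sum telescopes. -/

/-! ### Expectations under discrete distributions -/

section Expect

variable {α β : Type*}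

theorem PMF.summable_toReal (p : PMF α) : Summable fun x => (p x).toReal :=
  ENNReal.summable_toReal p.tsum_coe_ne_top

theorem PMF.tsum_toReal (p : PMF α) : ∑' x, (p x).toReal = 1 := by
  rw [← ENNReal.tsum_toReal_eq (fun x => p.apply_ne_top x), p.tsum_coe, ENNReal.toReal_one]

theorem PMF.sum_toReal [Fintype α] (p : PMF α) : ∑ x, (p x).toReal = 1 := by
  rw [← tsum_fintype (L := .unconditional _), p.tsum_toReal]

/-- A real `tsum` is zero by default when the family is not summable, which is why bounds on the
integrand accompany many of the rules for `expect`. -/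
theorem summable_expect (p : PMF α) {f : α → ℝ} {C : ℝ} (hf : ∀ x, |f x| ≤ C) :
    Summable fun x => (p x).toReal * f x := by
  refine Summable.of_norm_bounded (g := fun x => (p x).toReal * C) (p.summable_toReal.mul_right C) ?_
  intro x
  rw [Real.norm_eq_abs, abs_mul, abs_of_nonneg ENNReal.toReal_nonneg]
  exact mul_le_mul_of_nonneg_left (hf x) ENNReal.toReal_nonneg

theorem expect_fintype [Fintype α] (p : PMF α) (f : α → ℝ) :
    expect p f = ∑ x, (p x).toReal * f x := tsum_fintype _

theorem expect_const (p : PMF α) (c : ℝ) : expect p (fun _ => c) = c := by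
  rw [expect, tsum_mul_right, p.tsum_toReal, one_mul]

theorem expect_mono (p : PMF α) {f g : α → ℝ} {C D : ℝ} (hf : ∀ x, |f x| ≤ C)
    (hg : ∀ x, |g x| ≤ D) (h : ∀ x, f x ≤ g x) : expect p f ≤ expect p g :=
  (summable_expect p hf).tsum_le_tsum
    (fun x => mul_le_mul_of_nonneg_left (h x) ENNReal.toReal_nonneg) (summable_expect p hg)

theorem abs_expect_le (p : PMF α) {f : α → ℝ} {C : ℝ} (hf : ∀ x, |f x| ≤ C) :
    |expect p f| ≤ C := by
  have hc : ∀ x : α, |C| ≤ |C| := fun _ => le_rfl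
  have hc' : ∀ x : α, |-C| ≤ |C| := fun _ => (abs_neg C).le
  rw [abs_le]
  constructor
  · simpa [expect_const] using expect_mono p hc' hf fun x => (abs_le.1 (hf x)).1
  · simpa [expect_const] using expect_mono p hf hc fun x => (abs_le.1 (hf x)).2

theorem expect_add (p : PMF α) {f g : α → ℝ} {C D : ℝ} (hf : ∀ x, |f x| ≤ C)
    (hg : ∀ x, |g x| ≤ D) : expect p (fun x => f x + g x) = expect p f + expect p g := by
  simp only [expect, mul_add]
  exact (summable_expect p hf).tsum_add (summable_expect p hg)

theorem expect_const_mul (p : PMF α) (f : α → ℝ) (c : ℝ) :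
    expect p (fun x => c * f x) = c * expect p f := by
  simp only [expect, mul_left_comm _ c, tsum_mul_left]

theorem expect_finset_sum {ι : Type*} (s : Finset ι) (p : PMF α) {f : ι → α → ℝ} {C : ι → ℝ}
    (hf : ∀ j x, |f j x| ≤ C j) :
    expect p (fun x => ∑ j ∈ s, f j x) = ∑ j ∈ s, expect p (f j) := by
  simp only [expect, Finset.mul_sum]
  exact Summable.tsum_finsetSum fun j _ => summable_expect p (hf j)

theorem sum_mul_expect {ι : Type*} [Fintype ι] (p : PMF α) (b : ι → ℝ) {f : ι → α → ℝ} {C : ℝ}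
    (hf : ∀ j x, |f j x| ≤ C) :
    ∑ j, b j * expect p (f j) = expect p fun x => ∑ j, b j * f j x := by
  simp only [← expect_const_mul]
  rw [← expect_finset_sum Finset.univ p (C := fun j => |b j| * C)]
  intro j x
  rw [abs_mul]
  exact mul_le_mul_of_nonneg_left (hf j x) (abs_nonneg _)

theorem expect_pure (x : α) (f : α → ℝ) : expect (PMF.pure x) f = f x := by
  rw [expect, tsum_eq_single x]
  · simp
  · intro y hy
    simp [PMF.pure_apply, hy]

theorem expect_bind (p : PMF α) (k : α → PMF β) {f : β → ℝ} {C : ℝ} (hf : ∀ y, |f y| ≤ C) :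
    expect (p.bind k) f = expect p fun x => expect (k x) f := by
  -- The exchange of sums needs absolute summability of the double family; it is dominated by `C`
  -- times the joint masses, which have total one.
  have hp : Summable fun z : α × β => (p z.1).toReal * (k z.1 z.2).toReal := by
    refine (summable_prod_of_nonneg fun z =>
      mul_nonneg ENNReal.toReal_nonneg ENNReal.toReal_nonneg).2 ⟨fun x => ?_, ?_⟩
    · exact (k x).summable_toReal.mul_left (p x).toReal
    · simpa only [tsum_mul_left, PMF.tsum_toReal, mul_one] using p.summable_toReal
  have hs : Summable (Function.uncurry fun x y => (p x).toReal * (k x y).toReal * f y) := by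
    refine Summable.of_norm_bounded
      (g := fun z : α × β => (p z.1).toReal * (k z.1 z.2).toReal * C) (hp.mul_right C) ?_
    rintro ⟨x, y⟩
    simp only [Function.uncurry, Real.norm_eq_abs, abs_mul, abs_of_nonneg ENNReal.toReal_nonneg]
    exact mul_le_mul_of_nonneg_left (hf y)
      (mul_nonneg ENNReal.toReal_nonneg ENNReal.toReal_nonneg)
  have h1 : ∀ y, (p.bind k y).toReal * f y = ∑' x, (p x).toReal * (k x y).toReal * f y := by
    intro y
    rw [PMF.bind_apply, ENNReal.tsum_toReal_eq, ← tsum_mul_right]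
    · simp only [ENNReal.toReal_mul]
    · exact fun x => ENNReal.mul_ne_top (p.apply_ne_top x) ((k x).apply_ne_top y)
  simp only [expect, h1]
  rw [hs.tsum_comm]
  simp only [mul_assoc, tsum_mul_left]

theorem expect_map (p : PMF α) (g : α → β) {f : β → ℝ} {C : ℝ} (hf : ∀ y, |f y| ≤ C) :
    expect (p.map g) f = expect p fun x => f (g x) := by
  rw [← PMF.bind_pure_comp, expect_bind p _ hf]
  simp only [Function.comp, expect_pure]

/-! ### Sums with values in `[0, ∞]` -/

theorem PMF.tsum_bind_mul (p : PMF α) (k : α → PMF β) (f : β → ENNReal) :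
    ∑' y, p.bind k y * f y = ∑' x, p x * ∑' y, k x y * f y := by
  simp only [PMF.bind_apply, ← ENNReal.tsum_mul_right, ← ENNReal.tsum_mul_left]
  rw [ENNReal.tsum_comm]
  simp only [mul_assoc]

theorem PMF.tsum_pure_mul (x : α) (f : α → ENNReal) :
    ∑' y, PMF.pure x y * f y = f x := by
  rw [tsum_eq_single x]
  · simp
  · intro y hy
    simp [PMF.pure_apply, hy]

theorem PMF.tsum_map_mul (p : PMF α) (g : α → β) (f : β → ENNReal) :
    ∑' y, p.map g y * f y = ∑' x, p x * f (g x) := by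
  rw [← PMF.bind_pure_comp, PMF.tsum_bind_mul]
  simp only [Function.comp, PMF.tsum_pure_mul]

/-- Law of the unconscious statistician for a random element with a discrete law; the integrand
need not be measurable. -/
theorem lintegral_comp_of_pmf {S : Type*} [MeasurableSpace S] (P : Measure S)
    [IsProbabilityMeasure P] (X : S → α) (p : PMF α) (hm : ∀ x, MeasurableSet (X ⁻¹' {x}))
    (hP : ∀ x, P (X ⁻¹' {x}) = p x) (g : α → ENNReal) :
    ∫⁻ ω, g (X ω) ∂P = ∑' x, p x * g x := by
  have hc : p.support.Countable := p.support_countable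
  have hd : p.support.PairwiseDisjoint fun x => X ⁻¹' {x} := fun x _ y _ hxy =>
    Disjoint.preimage X (Set.disjoint_singleton.2 hxy)
  -- The support is countable, so the measurable fibres over it already carry all the mass; nothing
  -- has to be known about `g` elsewhere.
  have hU : P (⋃ x ∈ p.support, X ⁻¹' {x}) = 1 := by
    rw [measure_biUnion hc hd fun x _ => hm x]
    simp only [hP]
    rw [tsum_subtype p.support p, (Set.indicator_eq_self (s := p.support) (f := p)).2 (fun x hx => hx),
      p.tsum_coe]
  have hae : (⋃ x ∈ p.support, X ⁻¹' {x}) =ᵐ[P] Set.univ := by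
    rw [ae_eq_univ, prob_compl_eq_zero_iff (MeasurableSet.biUnion hc fun x _ => hm x)]
    exact hU
  rw [← setLIntegral_univ, ← setLIntegral_congr hae, lintegral_biUnion hc (fun x _ => hm x) hd]
  have h1 : ∀ x, ∫⁻ ω in X ⁻¹' {x}, g (X ω) ∂P = p x * g x := by
    intro x
    rw [setLIntegral_congr_fun (g := fun _ => g x) (hm x) (fun ω hω => by
      rw [Set.mem_preimage, Set.mem_singleton_iff] at hω; simp [hω]), setLIntegral_const, hP,
      mul_comm]
  simp only [h1]
  rw [tsum_subtype p.support fun x => p x * g x, Set.indicator_eq_self.2]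
  intro x hx
  exact left_ne_zero_of_mul hx

end Expect

/-! ### Two analytic lemmas -/

/-- Bayesian beliefs converge to a stationary limit when the likelihood ratios with respect to a
parameter of positive prior probability converge. -/
theorem exists_limit_of_likelihoodRatio {ι : Type*} [Fintype ι] {K b L : ℕ → ι → ℝ} {p l : ι → ℝ}
    {y : ι} (hKy : ∀ t, 0 < K t y) (hK : ∀ t j, 0 ≤ K t j)
    (hp : ∀ j, 0 ≤ p j) (hpy : 0 < p y) (hp1 : ∑ j, p j = 1) (hb0 : b 0 = p)
    (hb : ∀ t j, b (t + 1) j = K t j * b t j / ∑ j', K t j' * b t j')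
    (hL0 : ∀ j, L 0 j = 1) (hL : ∀ t j, L (t + 1) j = K t j / K t y * L t j)
    (hl : ∀ j, Tendsto (fun t => L t j) atTop (𝓝 (l j))) :
    ∃ q ∈ stdSimplex ℝ ι, Tendsto b atTop (𝓝 q) ∧
      Tendsto (fun t j => K t j * q j / ∑ j', K t j' * q j') atTop (𝓝 q) := by
  have hLn : ∀ t j, 0 ≤ L t j := by
    intro t j
    induction t with
    | zero => simp [hL0]
    | succ t ih => rw [hL]; exact mul_nonneg (div_nonneg (hK t j) (hKy t).le) ih
  have hLy : ∀ t, L t y = 1 := by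
    intro t
    induction t with
    | zero => simp [hL0]
    | succ t ih => rw [hL, ih, div_self (hKy t).ne', mul_one]
  have hln : ∀ j, 0 ≤ l j := fun j => ge_of_tendsto' (hl j) fun t => hLn t j
  have hly : l y = 1 := by
    have := hl y
    simp only [hLy] at this
    exact (tendsto_const_nhds_iff.1 this).symm
  -- The single term at `y` keeps the normalizing sum positive, also in the limit.
  have hN : ∀ M : ι → ℝ, (∀ j, 0 ≤ M j) → M y = 1 → 0 < ∑ j, p j * M j := by
    intro M hM hMy
    refine lt_of_lt_of_le ?_ (Finset.single_le_sum
      (fun j _ => mul_nonneg (hp j) (hM j)) (Finset.mem_univ y))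
    simpa [hMy] using hpy
  -- Closed form of the posterior. In the induction, consecutive Bayes denominators are quotients of
  -- consecutive normalizing sums, up to the factor `K t y`.
  have hbL : ∀ t j, b t j = p j * L t j / ∑ j', p j' * L t j' := by
    intro t
    induction t with
    | zero => intro j; simp [hb0, hL0, hp1]
    | succ t ih =>
      intro j
      have hk := (hKy t).ne'
      have h0 := (hN (L t) (hLn t) (hLy t)).ne'
      have h1 := (hN (L (t + 1)) (hLn _) (hLy _)).ne'
      have e1 : ∑ j', K t j' * b t j'
          = K t y * (∑ j', p j' * L (t + 1) j') / ∑ j', p j' * L t j' := by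
        rw [Finset.mul_sum, Finset.sum_div]
        refine Finset.sum_congr rfl fun j' _ => ?_
        rw [ih, hL]
        field_simp
      rw [hb, e1, ih]
      rw [show p j * L (t + 1) j = p j * (K t j / K t y * L t j) by rw [hL]]
      field_simp
  set N := ∑ j, p j * l j with hNdef
  have hNpos : 0 < N := hN l hln hly
  have hq1 : ∑ j, p j * l j / N = 1 := by rw [← Finset.sum_div, div_self hNpos.ne']
  refine ⟨fun j => p j * l j / N, ⟨fun j => div_nonneg (mul_nonneg (hp j) (hln j)) hNpos.le, hq1⟩,
    ?_, ?_⟩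
  · rw [tendsto_pi_nhds]
    intro j
    simp only [hbL]
    exact ((hl j).const_mul _).div (tendsto_finsetSum _ fun j' _ => (hl j').const_mul _) hNpos.ne'
  -- Dividing numerator and denominator of the update by `K t y` leaves one-step ratios. Such a
  -- ratio tends to one where `l j > 0`, and is multiplied by zero where `l j = 0`.
  · have hr : ∀ j, Tendsto (fun t => K t j / K t y * (p j * l j / N)) atTop
        (𝓝 (p j * l j / N)) := by
      intro j
      rcases (hln j).eq_or_lt with h | h
      · simp [← h]
      · have h1 : Tendsto (fun t => L (t + 1) j / L t j) atTop (𝓝 1) := by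
          have := ((tendsto_add_atTop_iff_nat 1).2 (hl j)).div (hl j) h.ne'
          rwa [div_self h.ne'] at this
        have h2 : (fun t => L (t + 1) j / L t j) =ᶠ[atTop] fun t => K t j / K t y := by
          filter_upwards [(hl j).eventually (lt_mem_nhds h)] with t ht
          rw [hL, mul_div_cancel_right₀ _ ht.ne']
        simpa using (h1.congr' h2).mul_const (p j * l j / N)
    rw [tendsto_pi_nhds]
    intro j
    have h3 := (hr j).div (tendsto_finsetSum Finset.univ fun j' _ => hr j') (by
      rw [hq1]; exact one_ne_zero)
    rw [hq1, div_one] at h3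
    refine h3.congr fun t => ?_
    have hk := (hKy t).ne'
    simp only [Pi.div_apply, div_mul_eq_mul_div, ← Finset.sum_div]
    rw [div_div_div_cancel_right₀ hk]

/-- Banach's fixed point theorem for operators on bounded real functions. -/
theorem exists_bounded_fixedPoint {X : Type*} {γ : ℝ} (hγ₀ : 0 ≤ γ) (hγ₁ : γ < 1)
    (T : (X → ℝ) → X → ℝ) (hbdd : ∀ f C, (∀ x, |f x| ≤ C) → ∃ D, ∀ x, |T f x| ≤ D)
    (hT : ∀ f g C, 0 ≤ C → (∃ D, ∀ x, |f x| ≤ D) → (∃ D, ∀ x, |g x| ≤ D) →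
      (∀ x, |f x - g x| ≤ C) → ∀ x, |T f x - T g x| ≤ γ * C) :
    ∃ f : X → ℝ, (∃ C, ∀ x, |f x| ≤ C) ∧ T f = f := by
  -- In the discrete topology all bounded functions are continuous, so the complete space of bounded
  -- continuous functions consists of all bounded functions.
  let _ : TopologicalSpace X := ⊥
  have : DiscreteTopology X := ⟨rfl⟩
  have hb : ∀ f : BoundedContinuousFunction X ℝ, ∃ D, ∀ x, |f x| ≤ D :=
    fun f => ⟨‖f‖, fun x => f.norm_coe_le_norm x⟩
  choose D hD using fun f : BoundedContinuousFunction X ℝ =>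
    hbdd f ‖f‖ (fun x => f.norm_coe_le_norm x)
  let Φ : BoundedContinuousFunction X ℝ → BoundedContinuousFunction X ℝ := fun f =>
    BoundedContinuousFunction.ofNormedAddCommGroupDiscrete (T f) (D f) (hD f)
  have hΦ : ContractingWith ⟨γ, hγ₀⟩ Φ := by
    refine ⟨hγ₁, LipschitzWith.of_dist_le_mul fun f g => ?_⟩
    rw [BoundedContinuousFunction.dist_le (by positivity)]
    intro x
    exact hT f g (dist f g) dist_nonneg (hb f) (hb g)
      (fun x => by
        rw [← Real.dist_eq]; exact BoundedContinuousFunction.dist_coe_le_dist x) x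
  let φ : BoundedContinuousFunction X ℝ := ContractingWith.fixedPoint Φ hΦ
  refine ⟨φ, hb φ, ?_⟩
  exact congrArg (fun f : BoundedContinuousFunction X ℝ => (f : X → ℝ)) hΦ.fixedPoint_isFixedPt

/-! ### Convergence of beliefs about types along a run -/

namespace FogGame

variable {F : Type*} [DecidableEq F] {Y A : F → Type*} {U O Z : Type*}

section Run

variable (G : FogGame F Y A U O Z) (i : F)

/-! ### The likelihood ratio under the discrete law of the process -/

theorem tsum_runLaw_succ_mul (β : Behaviour A U O i) (init : PMF (U × OtherTypes Y i)) (t : ℕ)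
    (g : (U × OtherTypes Y i) × List (U × A i × O) → ENNReal) :
    ∑' r, G.runLaw i β init (t + 1) r * g r =
      ∑' r, G.runLaw i β init t r * ∑' a, β r.2 r.1.1 a *
        ∑' u', G.stateKernel i r.1.2 r.1.1 a u' *
          ∑' o, G.observation i a u' o * g ((u', r.1.2), (r.1.1, a, o) :: r.2) := by
  simp only [runLaw, PMF.tsum_bind_mul, PMF.tsum_map_mul]

/-- Types never change during a run. With an indicator for `e`, this shows that wrong types have
probability zero. -/
theorem tsum_runLaw_mul_types (β : Behaviour A U O i) (u₀ : U) (y : OtherTypes Y i)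
    (e : OtherTypes Y i → ENNReal) (t : ℕ) :
    ∑' r, G.runLaw i β (PMF.pure (u₀, y)) t r * e r.1.2 = e y := by
  induction t with
  | zero => rw [runLaw, PMF.tsum_map_mul, PMF.tsum_pure_mul]
  | succ t ih =>
    rw [tsum_runLaw_succ_mul]
    simpa only [ENNReal.tsum_mul_right, PMF.tsum_coe, one_mul] using ih

theorem runLaw_pure_eq_zero (β : Behaviour A U O i) (u₀ : U) {y y' : OtherTypes Y i}
    (hy : y' ≠ y) (t : ℕ) (w : U) (h : List (U × A i × O)) :
    G.runLaw i β (PMF.pure (u₀, y)) t ((w, y'), h) = 0 := by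
  classical
  have key := G.tsum_runLaw_mul_types i β u₀ y (fun z => if z = y then 0 else 1) t
  rw [if_pos rfl] at key
  have := ENNReal.tsum_eq_zero.1 key ((w, y'), h)
  simpa [hy] using this

/-- Likelihood ratio of the types `y'` with respect to the types `y`, given the present physical
state and the past. -/
noncomputable def likelihoodRatio (y y' : OtherTypes Y i) : U → List (U × A i × O) → ℝ
  | _, [] => 1
  | w, e :: h => (G.stateKernel i y' e.1 e.2.1 w).toReal / (G.stateKernel i y e.1 e.2.1 w).toReal *
      likelihoodRatio y y' e.1 h

theorem likelihoodRatio_nonneg (y y' : OtherTypes Y i) (w : U) (h : List (U × A i × O)) :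
    0 ≤ G.likelihoodRatio i y y' w h := by
  induction h generalizing w with
  | nil => exact zero_le_one
  | cons e h ih => exact mul_nonneg (div_nonneg ENNReal.toReal_nonneg ENNReal.toReal_nonneg) (ih _)

/-- Only an inequality: for `p = 0` the left side vanishes while `q` may be positive. The mass of
transitions that `y'` allows and `y` forbids is lost, so the likelihood ratio is in general a
supermartingale and not a martingale. -/
theorem mul_ofReal_div_toReal_le {p q : ENNReal} (hp : p ≠ ⊤) (hq : q ≠ ⊤) :
    p * ENNReal.ofReal (q.toReal / p.toReal) ≤ q := by
  rcases eq_or_ne p 0 with rfl | h0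
  · simp
  · rw [ENNReal.ofReal_div_of_pos (ENNReal.toReal_pos h0 hp), ENNReal.ofReal_toReal hp,
      ENNReal.ofReal_toReal hq]
    exact ENNReal.mul_div_le

/-- The data at the beginning of the previous slot. -/
def previous : (U × OtherTypes Y i) × List (U × A i × O) → (U × OtherTypes Y i) × List (U × A i × O)
  | (s, []) => (s, [])
  | (s, e :: h) => ((e.1, s.2), h)

/-- The likelihood ratio is a supermartingale under the law of the true types. -/
theorem tsum_runLaw_succ_likelihoodRatio_le (β : Behaviour A U O i) (u₀ : U)
    (y y' : OtherTypes Y i) (t : ℕ)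
    (c : (U × OtherTypes Y i) × List (U × A i × O) → ENNReal) :
    ∑' r, G.runLaw i β (PMF.pure (u₀, y)) (t + 1) r *
        (c (previous i r) * ENNReal.ofReal (G.likelihoodRatio i y y' r.1.1 r.2)) ≤
      ∑' r, G.runLaw i β (PMF.pure (u₀, y)) t r *
        (c r * ENNReal.ofReal (G.likelihoodRatio i y y' r.1.1 r.2)) := by
  rw [tsum_runLaw_succ_mul]
  refine ENNReal.tsum_le_tsum fun r => ?_
  obtain ⟨⟨w, z⟩, h⟩ := r
  rcases eq_or_ne z y with rfl | hz
  · gcongr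
    simp only [previous, ENNReal.tsum_mul_right, PMF.tsum_coe, one_mul, likelihoodRatio]
    set B := c ((w, z), h) * ENNReal.ofReal (G.likelihoodRatio i z y' w h)
    -- The denominator of the ratio cancels against the true kernel, and what remains is the kernel
    -- for `y'`, whose total mass is one.
    calc _ ≤ ∑' a, β h w a * ∑' u', G.stateKernel i y' w a u' * B := by
          refine ENNReal.tsum_le_tsum fun a => mul_le_mul_right ?_ _
          refine ENNReal.tsum_le_tsum fun u' => ?_
          rw [ENNReal.ofReal_mul (div_nonneg ENNReal.toReal_nonneg ENNReal.toReal_nonneg),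
            mul_left_comm (c _), ← mul_assoc]
          gcongr
          exact mul_ofReal_div_toReal_le (PMF.apply_ne_top _ _) (PMF.apply_ne_top _ _)
      _ = B := by simp only [ENNReal.tsum_mul_right, PMF.tsum_coe, one_mul]
  · rw [runLaw_pure_eq_zero G i β u₀ hz, zero_mul, zero_mul]

open Classical in
/-- Indicator of the event that the last transition of the physical state was impossible. -/
noncomputable def impossible : (U × OtherTypes Y i) × List (U × A i × O) → ENNReal
  | (_, []) => 0
  | (s, e :: _) => if G.stateKernel i s.2 e.1 e.2.1 s.1 = 0 then 1 else 0

theorem tsum_runLaw_impossible (β : Behaviour A U O i) (init : PMF (U × OtherTypes Y i)) (t : ℕ) :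
    ∑' r, G.runLaw i β init (t + 1) r * G.impossible i r = 0 := by
  rw [tsum_runLaw_succ_mul]
  simp only [impossible, ENNReal.tsum_eq_zero, mul_eq_zero]
  refine fun r => Or.inr fun a => Or.inr fun u' => or_iff_not_imp_left.2 fun h o => ?_
  exact Or.inr (if_neg h)

/-! ### Transfer to the probability space of a run -/

variable {G i}
variable {β : Behaviour A U O i} {u₀ : U} {y : OtherTypes Y i} {S : Type*}
  {u : ℕ → S → U} {a : ℕ → S → A i} {o : ℕ → S → O}

/-- Physical state, types of the others and past at the beginning of slot `t` of a run. -/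
def runPosition (y : OtherTypes Y i) (u : ℕ → S → U) (a : ℕ → S → A i) (o : ℕ → S → O) (t : ℕ)
    (ω : S) : (U × OtherTypes Y i) × List (U × A i × O) :=
  ((u t ω, y), past (fun s => u s ω) (fun s => a s ω) (fun s => o s ω) t)

/-- The likelihood ratio along a run. -/
noncomputable def runRatio (G : FogGame F Y A U O Z) (y y' : OtherTypes Y i) (u : ℕ → S → U)
    (a : ℕ → S → A i) (o : ℕ → S → O) (t : ℕ) (ω : S) : ℝ :=
  G.likelihoodRatio i y y' (u t ω) (past (fun s => u s ω) (fun s => a s ω) (fun s => o s ω) t)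

theorem runRatio_nonneg (y' : OtherTypes Y i) (t : ℕ) (ω : S) : 0 ≤ runRatio G y y' u a o t ω :=
  G.likelihoodRatio_nonneg i y y' _ _

variable [mS : MeasurableSpace S] {P : Measure S}

theorem IsRun.measurableSet_past (hrun : G.IsRun i β u₀ y P u a o) (t : ℕ)
    (h : List (U × A i × O)) :
    MeasurableSet {ω | past (fun s => u s ω) (fun s => a s ω) (fun s => o s ω) t = h} := by
  induction t generalizing h with
  | zero => simp only [past, MeasurableSet.const]
  | succ t ih =>
    cases h with
    | nil => simp [past]
    | cons e h =>
      obtain ⟨w, c, x⟩ := e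
      have h1 : MeasurableSet (u t ⁻¹' {w}) := hrun.measurable_state t trivial
      have h2 : MeasurableSet (a t ⁻¹' {c}) := hrun.measurable_action t trivial
      have h3 : MeasurableSet (o (t + 1) ⁻¹' {x}) := hrun.measurable_obs (t + 1) trivial
      convert ((h1.inter h2).inter h3).inter (ih h) using 1
      ext ω
      simp [past, and_assoc]

theorem IsRun.measurableSet_runPosition (hrun : G.IsRun i β u₀ y P u a o) (t : ℕ)
    (r : (U × OtherTypes Y i) × List (U × A i × O)) :
    MeasurableSet (runPosition y u a o t ⁻¹' {r}) := by
  obtain ⟨⟨w, z⟩, h⟩ := r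
  have h1 : MeasurableSet (u t ⁻¹' {w}) := hrun.measurable_state t trivial
  have h2 : MeasurableSet {_ω : S | y = z} := MeasurableSet.const _
  convert (h1.inter h2).inter (hrun.measurableSet_past t h) using 1
  ext ω
  simp [runPosition]

theorem IsRun.measure_runPosition (hrun : G.IsRun i β u₀ y P u a o) (t : ℕ)
    (r : (U × OtherTypes Y i) × List (U × A i × O)) :
    P (runPosition y u a o t ⁻¹' {r}) = G.runLaw i β (PMF.pure (u₀, y)) t r := by
  obtain ⟨⟨w, z⟩, h⟩ := r
  rcases eq_or_ne z y with rfl | hz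
  · rw [← hrun.law t w h]
    congr 1
    ext ω
    simp [runPosition]
  · rw [runLaw_pure_eq_zero G i β u₀ hz]
    convert measure_empty (μ := P)
    ext ω
    simp [runPosition, hz.symm]

theorem IsRun.lintegral_runPosition [IsProbabilityMeasure P] (hrun : G.IsRun i β u₀ y P u a o)
    (t : ℕ) (g : (U × OtherTypes Y i) × List (U × A i × O) → ENNReal) :
    ∫⁻ ω, g (runPosition y u a o t ω) ∂P =
      ∑' r, G.runLaw i β (PMF.pure (u₀, y)) t r * g r :=
  lintegral_comp_of_pmf P _ _ (hrun.measurableSet_runPosition t) (hrun.measure_runPosition t) g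

/-- The filtration of measurable events that are determined by the past. -/
def runFiltration (y : OtherTypes Y i) (u : ℕ → S → U) (a : ℕ → S → A i) (o : ℕ → S → O) :
    Filtration ℕ mS where
  -- Histories carry the discrete σ-algebra. For an uncountable action set the preimage of a set of
  -- histories need not be measurable, hence the intersection with `mS`.
  seq t := MeasurableSpace.comap (runPosition y u a o t) ⊤ ⊓ mS
  mono' := by
    refine monotone_nat_of_le_succ fun t => inf_le_inf_right _ ?_
    rintro s ⟨B, -, rfl⟩
    -- The position in slot `t` is a function of the position in slot `t + 1`.
    exact ⟨previous i ⁻¹' B, trivial, rfl⟩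
  le' _ := inf_le_right

/-- Fixing the finitely many values of both physical states of a transition leaves a function of the
action alone; thus joint measurability on a product with the action set is never needed. -/
theorem measurable_of_finite_left {γ δ : Type*} [Finite γ] [MeasurableSpace δ] {f : S → γ}
    (hf : Measurable[mS, ⊤] f) {g : γ → S → δ} (hg : ∀ c, Measurable (g c)) :
    Measurable fun ω => g (f ω) ω := by
  intro B hB
  have : (fun ω => g (f ω) ω) ⁻¹' B = ⋃ c, f ⁻¹' {c} ∩ g c ⁻¹' B := by
    ext ω
    simp
  rw [this]
  have : ∀ c, MeasurableSet (f ⁻¹' {c}) := fun c => hf trivial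
  exact MeasurableSet.iUnion fun c => (this c).inter (hg c hB)

theorem IsRun.measurable_transition [Finite U] (hrun : G.IsRun i β u₀ y P u a o)
    {δ : Type*} [MeasurableSpace δ] (f : U → A i → U → δ) (t : ℕ) :
    Measurable fun ω => f (u t ω) (a t ω) (u (t + 1) ω) := by
  refine measurable_of_finite_left (hrun.measurable_state t)
    (g := fun w ω => f w (a t ω) (u (t + 1) ω)) fun w => ?_
  refine measurable_of_finite_left (hrun.measurable_state (t + 1))
    (g := fun w' ω => f w (a t ω) w') fun w' => ?_
  have h1 : Measurable[⊤] fun c => f w c w' := fun _ _ => trivial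
  exact h1.comp (hrun.measurable_action t)

theorem IsRun.measurable_runRatio [Finite U] (hrun : G.IsRun i β u₀ y P u a o)
    (y' : OtherTypes Y i) (t : ℕ) : Measurable (runRatio G y y' u a o t) := by
  induction t with
  | zero => exact measurable_const
  | succ t ih =>
    exact (hrun.measurable_transition (fun w c w' => (G.stateKernel i y' w c w').toReal /
      (G.stateKernel i y w c w').toReal) t).mul ih

theorem IsRun.setLIntegral_runRatio_succ_le [Finite U] [IsProbabilityMeasure P]
    (hrun : G.IsRun i β u₀ y P u a o) (y' : OtherTypes Y i) (t : ℕ) {s : Set S}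
    (hs : MeasurableSet[runFiltration y u a o t] s) :
    ∫⁻ ω in s, ENNReal.ofReal (runRatio G y y' u a o (t + 1) ω) ∂P ≤
      ∫⁻ ω in s, ENNReal.ofReal (runRatio G y y' u a o t ω) ∂P := by
  classical
  obtain ⟨⟨B, -, rfl⟩, hm⟩ := MeasurableSpace.measurableSet_inf.1 hs
  rw [← lintegral_indicator hm, ← lintegral_indicator hm]
  -- An event of the filtration is given by a set `B` of positions; its indicator is the weight `c`.
  have key := G.tsum_runLaw_succ_likelihoodRatio_le i β u₀ y y' t (B.indicator 1)
  rw [← hrun.lintegral_runPosition, ← hrun.lintegral_runPosition] at key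
  have hprev : ∀ ω, previous i (runPosition y u a o (t + 1) ω) = runPosition y u a o t ω :=
    fun _ => rfl
  simp only [hprev] at key
  convert key using 3 with ω ω
  all_goals
    by_cases h : runPosition y u a o t ω ∈ B
    · rw [Set.indicator_of_mem (Set.mem_preimage.2 h), Set.indicator_of_mem h, Pi.one_apply, one_mul]
      rfl
    · rw [Set.indicator_of_notMem (fun h' => h (Set.mem_preimage.1 h')),
        Set.indicator_of_notMem h, zero_mul]

theorem IsRun.lintegral_runRatio_le [Finite U] [IsProbabilityMeasure P]
    (hrun : G.IsRun i β u₀ y P u a o) (y' : OtherTypes Y i) (t : ℕ) :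
    ∫⁻ ω, ENNReal.ofReal (runRatio G y y' u a o t ω) ∂P ≤ 1 := by
  induction t with
  | zero => simp [runRatio, past, likelihoodRatio]
  | succ t ih =>
    refine le_trans ?_ ih
    simpa using hrun.setLIntegral_runRatio_succ_le y' t MeasurableSet.univ

theorem IsRun.integrable_runRatio [Finite U] [IsProbabilityMeasure P]
    (hrun : G.IsRun i β u₀ y P u a o) (y' : OtherTypes Y i) (t : ℕ) :
    Integrable (runRatio G y y' u a o t) P := by
  refine ⟨(hrun.measurable_runRatio y' t).aestronglyMeasurable, ?_⟩
  rw [hasFiniteIntegral_iff_ofReal (ae_of_all _ (runRatio_nonneg y' t))]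
  exact (hrun.lintegral_runRatio_le y' t).trans_lt ENNReal.one_lt_top

theorem IsRun.submartingale_neg_runRatio [Finite U] [IsProbabilityMeasure P]
    (hrun : G.IsRun i β u₀ y P u a o) (y' : OtherTypes Y i) :
    Submartingale (fun t ω => -runRatio G y y' u a o t ω) (runFiltration y u a o) P := by
  have hint := hrun.integrable_runRatio y'
  refine submartingale_of_setIntegral_le_succ (fun t => ?_) (fun t => (hint t).neg) fun t s hs => ?_
  · refine Measurable.stronglyMeasurable (Measurable.neg fun B hB => ?_)
    refine MeasurableSpace.measurableSet_inf.2 ⟨?_, hrun.measurable_runRatio y' t hB⟩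
    exact ⟨(fun r => G.likelihoodRatio i y y' r.1.1 r.2) ⁻¹' B, trivial, rfl⟩
  · rw [integral_neg, integral_neg, neg_le_neg_iff,
      integral_eq_lintegral_of_nonneg_ae (ae_of_all _ (runRatio_nonneg y' _))
        (hint _).aestronglyMeasurable.restrict,
      integral_eq_lintegral_of_nonneg_ae (ae_of_all _ (runRatio_nonneg y' _))
        (hint _).aestronglyMeasurable.restrict]
    refine ENNReal.toReal_mono ?_ (hrun.setLIntegral_runRatio_succ_le y' t hs)
    exact ((setLIntegral_le_lintegral _ _).trans_lt
      ((hrun.lintegral_runRatio_le y' t).trans_lt ENNReal.one_lt_top)).ne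

/-- Nonnegativity turns the bound one on the mean into an `L¹` bound, and the submartingale
convergence theorem applies to the negative of the ratio. -/
theorem IsRun.ae_exists_tendsto_runRatio [Finite U] [IsProbabilityMeasure P]
    (hrun : G.IsRun i β u₀ y P u a o) (y' : OtherTypes Y i) :
    ∀ᵐ ω ∂P, ∃ l, Tendsto (fun t => runRatio G y y' u a o t ω) atTop (𝓝 l) := by
  have := (hrun.submartingale_neg_runRatio y').exists_ae_tendsto_of_bdd (R := 1) fun t => by
    rw [eLpNorm_one_eq_lintegral_enorm]
    refine le_of_eq_of_le (lintegral_congr fun ω => ?_) (hrun.lintegral_runRatio_le y' t)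
    rw [enorm_neg, Real.enorm_of_nonneg (runRatio_nonneg y' t ω)]
  filter_upwards [this] with ω ⟨l, hl⟩
  exact ⟨-l, by simpa using hl.neg⟩

/-- Almost surely no denominator of the likelihood ratio vanishes, so the formula for the posterior
involves no division by zero. -/
theorem IsRun.ae_stateKernel_ne_zero [Finite U] [IsProbabilityMeasure P]
    (hrun : G.IsRun i β u₀ y P u a o) :
    ∀ᵐ ω ∂P, ∀ t, G.stateKernel i y (u t ω) (a t ω) (u (t + 1) ω) ≠ 0 := by
  classical
  rw [ae_all_iff]
  intro t
  have h0 := G.tsum_runLaw_impossible i β (PMF.pure (u₀, y)) t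
  rw [← hrun.lintegral_runPosition] at h0
  filter_upwards [(lintegral_eq_zero_iff (hrun.measurable_transition
    (fun w c w' => if G.stateKernel i y w c w' = 0 then (1 : ENNReal) else 0) t)).1 h0] with ω hω h
  exact one_ne_zero ((if_pos h).symm.trans hω)

variable [Fintype F] [∀ j, Fintype (Y j)]

/-- The beliefs about types converge almost surely to a stationary belief. -/
theorem IsRun.ae_exists_tendsto_typeBeliefSeq [Finite U] [IsProbabilityMeasure P]
    (hrun : G.IsRun i β u₀ y P u a o) (prior : PMF (OtherTypes Y i)) (hy : prior y ≠ 0) :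
    ∀ᵐ ω ∂P, ∃ q ∈ stdSimplex ℝ (OtherTypes Y i),
      Tendsto (G.typeBeliefSeq i (fun y' => (prior y').toReal) (fun t => u t ω) (fun t => a t ω))
        atTop (𝓝 q) ∧
      Tendsto (fun t => G.typeBeliefUpdate i q (u t ω) (a t ω) (u (t + 1) ω)) atTop (𝓝 q) ∧
      ∀ w c w', (∃ᶠ t in atTop, u t ω = w ∧ a t ω = c ∧ u (t + 1) ω = w') →
        G.typeBeliefUpdate i q w c w' = q := by
  filter_upwards [hrun.ae_stateKernel_ne_zero,
    ae_all_iff.2 fun y' => hrun.ae_exists_tendsto_runRatio y'] with ω hpos hlim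
  choose l hl using hlim
  obtain ⟨q, hq, h1, h2⟩ := exists_limit_of_likelihoodRatio
    (K := fun t y' => (G.stateKernel i y' (u t ω) (a t ω) (u (t + 1) ω)).toReal)
    (b := G.typeBeliefSeq i (fun y' => (prior y').toReal) (fun t => u t ω) (fun t => a t ω))
    (L := fun t y' => runRatio G y y' u a o t ω) (p := fun y' => (prior y').toReal) (y := y)
    (fun t => ENNReal.toReal_pos (hpos t) (PMF.apply_ne_top _ _))
    (fun _ _ => ENNReal.toReal_nonneg) (fun _ => ENNReal.toReal_nonneg)
    (ENNReal.toReal_pos hy (PMF.apply_ne_top _ _)) prior.sum_toReal rfl (fun _ _ => rfl)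
    (fun _ => rfl) (fun _ _ => rfl) hl
  refine ⟨q, hq, h1, h2, fun w c w' hf => ?_⟩
  -- The updates converge to `q` and take the value given by a recurrent transition infinitely
  -- often, so this value is `q`.
  by_contra hne
  have := (h2.eventually (isOpen_ne.mem_nhds (Ne.symm hne))).and_frequently hf
  obtain ⟨t, ht, rfl, rfl, rfl⟩ := this.exists
  exact ht rfl

end Run

end FogGame

/-! ### Suprema, sums and discounting -/

/-- Suprema are nonexpansive in the uniform norm; this passes the contraction estimate from single
actions to the Bellman operator. -/
theorem abs_sub_le_of_isLUB_range {α : Type*} {f g : α → ℝ} {x y D : ℝ}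
    (hx : IsLUB (Set.range f) x) (hy : IsLUB (Set.range g) y) (h : ∀ a, |f a - g a| ≤ D) :
    |x - y| ≤ D := by
  rw [abs_le]
  have h1 : x ≤ y + D := hx.2 <| by
    rintro _ ⟨a, rfl⟩
    linarith [(abs_le.1 (h a)).2, hy.1 ⟨a, rfl⟩]
  have h2 : y ≤ x + D := hy.2 <| by
    rintro _ ⟨a, rfl⟩
    linarith [(abs_le.1 (h a)).1, hx.1 ⟨a, rfl⟩]
  constructor <;> linarith

theorem Finset.sum_reverse₄ {α β γ δ M : Type*} [AddCommMonoid M] (s : Finset α) (t : Finset β)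
    (u : Finset γ) (v : Finset δ) (f : α → β → γ → δ → M) :
    ∑ a ∈ s, ∑ b ∈ t, ∑ c ∈ u, ∑ d ∈ v, f a b c d =
      ∑ d ∈ v, ∑ c ∈ u, ∑ b ∈ t, ∑ a ∈ s, f a b c d := by
  have h3 : ∀ a, ∑ b ∈ t, ∑ c ∈ u, ∑ d ∈ v, f a b c d =
      ∑ d ∈ v, ∑ c ∈ u, ∑ b ∈ t, f a b c d := by
    intro a
    rw [Finset.sum_comm]
    simp only [Finset.sum_comm (s := t) (t := v)]
    rw [Finset.sum_comm]
  simp only [h3]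
  rw [Finset.sum_comm]
  refine Finset.sum_congr rfl fun d _ => ?_
  rw [Finset.sum_comm]
  exact Finset.sum_congr rfl fun c _ => Finset.sum_comm

theorem abs_sum_mul_le {ι : Type*} [Fintype ι] {b f : ι → ℝ} {C : ℝ} (hC : 0 ≤ C)
    (hb : ∀ j, 0 ≤ b j) (hb1 : ∑ j, b j ≤ 1) (hf : ∀ j, |f j| ≤ C) : |∑ j, b j * f j| ≤ C :=
  calc |∑ j, b j * f j| ≤ ∑ j, |b j * f j| := Finset.abs_sum_le_sum_abs _ _
    _ ≤ ∑ j, b j * C := Finset.sum_le_sum fun j _ => by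
        rw [abs_mul, abs_of_nonneg (hb j)]
        exact mul_le_mul_of_nonneg_left (hf j) (hb j)
    _ = (∑ j, b j) * C := (Finset.sum_mul ..).symm
    _ ≤ C := mul_le_of_le_one_left hC hb1

theorem summable_discounted {γ : ℝ} (hγ₀ : 0 ≤ γ) (hγ₁ : γ < 1) {r : ℕ → ℝ} {C : ℝ}
    (hr : ∀ t, |r t| ≤ C) : Summable fun t => γ ^ t * r t := by
  refine Summable.of_norm_bounded (g := fun t => γ ^ t * C)
    ((summable_geometric_of_lt_one hγ₀ hγ₁).mul_right C) fun t => ?_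
  rw [Real.norm_eq_abs, abs_mul, abs_of_nonneg (pow_nonneg hγ₀ t)]
  exact mul_le_mul_of_nonneg_left (hr t) (pow_nonneg hγ₀ t)

/-- The inequality of slot `t`, multiplied by `γ ^ t`, telescopes, and the remainder `γ ^ n * V n`
tends to zero. -/
theorem tsum_discounted_le {γ : ℝ} (hγ₀ : 0 ≤ γ) (hγ₁ : γ < 1) {r V : ℕ → ℝ} {C D : ℝ}
    (hr : ∀ t, |r t| ≤ C) (hV : ∀ t, |V t| ≤ D) (h : ∀ t, r t + γ * V (t + 1) ≤ V t) :
    ∑' t, γ ^ t * r t ≤ V 0 := by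
  have h1 : ∀ n, ∑ t ∈ Finset.range n, γ ^ t * r t ≤ V 0 - γ ^ n * V n := by
    intro n
    induction n with
    | zero => simp
    | succ n ih =>
      rw [Finset.sum_range_succ, pow_succ]
      linarith [mul_le_mul_of_nonneg_left (h n) (pow_nonneg hγ₀ n)]
  have h2 : Tendsto (fun n => V 0 - γ ^ n * V n) atTop (𝓝 (V 0 - 0)) :=
    tendsto_const_nhds.sub (summable_discounted hγ₀ hγ₁ hV).tendsto_atTop_zero
  rw [sub_zero] at h2
  exact le_of_tendsto_of_tendsto' (summable_discounted hγ₀ hγ₁ hr).hasSum.tendsto_sum_nat h2 h1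

theorem tsum_discounted_eq {γ : ℝ} (hγ₀ : 0 ≤ γ) (hγ₁ : γ < 1) {r V : ℕ → ℝ} {C D : ℝ}
    (hr : ∀ t, |r t| ≤ C) (hV : ∀ t, |V t| ≤ D) (h : ∀ t, r t + γ * V (t + 1) = V t) :
    ∑' t, γ ^ t * r t = V 0 := by
  refine le_antisymm (tsum_discounted_le hγ₀ hγ₁ hr hV fun t => (h t).le) ?_
  have := tsum_discounted_le hγ₀ hγ₁ (r := fun t => -r t) (V := fun t => -V t)
    (fun t => (abs_neg _).trans_le (hr t)) (fun t => (abs_neg _).trans_le (hV t))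
    fun t => by linarith [h t]
  simp only [mul_neg, tsum_neg] at this
  linarith

/-! ### Belief states -/

namespace FogGame

variable {F : Type*} [DecidableEq F] {Y A : F → Type*} {U O Z : Type*}

theorem abs_slotReward_le {G : FogGame F Y A U O Z} {i : F} {C : ℝ}
    (hC : ∀ u a, |G.reward i u a| ≤ C) (y : OtherTypes Y i) (u : U) (a : A i) :
    |G.slotReward i y u a| ≤ C :=
  abs_expect_le _ fun _ => hC _ _

theorem jointProb_nonneg (G : FogGame F Y A U O Z) [Fintype U] {i : F} {b : U × OtherTypes Y i → ℝ} (hb : ∀ s, 0 ≤ b s) (a : A i) (z : Z)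
    (o : O) (s : U × OtherTypes Y i) : 0 ≤ G.jointProb b a z o s := by
  refine mul_nonneg ENNReal.toReal_nonneg (Finset.sum_nonneg fun u _ => ?_)
  split_ifs
  · exact mul_nonneg ENNReal.toReal_nonneg (hb _)
  · exact le_rfl

variable [Fintype F] [∀ j, Fintype (Y j)] {i : F}

theorem eq_zero_of_stateBelief_eq_zero {b : U × OtherTypes Y i → ℝ} (hb : ∀ s, 0 ≤ b s) {u : U}
    (h : stateBelief b u = 0) (y : OtherTypes Y i) : b (u, y) = 0 :=
  (Finset.sum_eq_zero_iff_of_nonneg fun y _ => hb (u, y)).1 h y (Finset.mem_univ y)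

/-- The conditional belief under a state of belief zero is `0 / 0 = 0`; the product is still right,
because nonnegativity then forces `b (u, y) = 0`. -/
theorem stateBelief_mul_typeBelief {b : U × OtherTypes Y i → ℝ} (hb : ∀ s, 0 ≤ b s) (u : U)
    (y : OtherTypes Y i) : stateBelief b u * typeBelief b u y = b (u, y) :=
  mul_div_cancel_of_imp' fun h => eq_zero_of_stateBelief_eq_zero hb h y

variable [Fintype U] (G : FogGame F Y A U O Z)

theorem signalProb_nonneg {b : U × OtherTypes Y i → ℝ} (hb : ∀ s, 0 ≤ b s) (a : A i) (z : Z)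
    (o : O) : 0 ≤ G.signalProb b a z o :=
  Finset.sum_nonneg fun s _ => G.jointProb_nonneg hb a z o s

theorem signalProb_mul_beliefUpdate {b : U × OtherTypes Y i → ℝ} (hb : ∀ s, 0 ≤ b s) (a : A i)
    (z : Z) (o : O) (s : U × OtherTypes Y i) :
    G.signalProb b a z o * G.beliefUpdate b a z o s = G.jointProb b a z o s :=
  mul_div_cancel_of_imp' fun h =>
    (Finset.sum_eq_zero_iff_of_nonneg fun s _ => G.jointProb_nonneg hb a z o s).1 h s
      (Finset.mem_univ s)

theorem beliefUpdate_mem_stdSimplex {b : U × OtherTypes Y i → ℝ} (hb : ∀ s, 0 ≤ b s) {a : A i}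
    {z : Z} {o : O} (h : G.signalProb b a z o ≠ 0) :
    G.beliefUpdate b a z o ∈ stdSimplex ℝ (U × OtherTypes Y i) := by
  refine ⟨fun s => div_nonneg (G.jointProb_nonneg hb a z o s) (G.signalProb_nonneg hb a z o), ?_⟩
  simp only [beliefUpdate, ← Finset.sum_div]
  exact div_self h

/-- If the past physical state is disclosed, the type component of the belief is updated by Bayes'
rule for the observed transition. -/
theorem typeBelief_beliefUpdate {b : U × OtherTypes Y i → ℝ} (hb : ∀ s, 0 ≤ b s) (a : A i) (o : O)
    (u u' : U) (hu : ∀ w, G.outcome i w = G.outcome i u → w = u)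
    (h : stateBelief (G.beliefUpdate b a (G.outcome i u) o) u' ≠ 0) :
    typeBelief (G.beliefUpdate b a (G.outcome i u) o) u' =
      G.typeBeliefUpdate i (typeBelief b u) u a u' := by
  -- The observation factor `c` and the normalizer `N` do not depend on the types and cancel on
  -- conditioning on `u'`. Disclosure leaves only the past state `u` in the sum within `jointProb`.
  set c := (G.observation i a u' o).toReal with hc
  set N := G.signalProb b a (G.outcome i u) o with hN
  have h1 : ∀ y, G.beliefUpdate b a (G.outcome i u) o (u', y) =
      c * ((G.stateKernel i y u a u').toReal * b (u, y)) / N := by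
    intro y
    rw [beliefUpdate, jointProb, Finset.sum_eq_single u]
    · rw [if_pos rfl]
    · exact fun w _ hw => if_neg fun hw' => hw (hu w hw')
    · exact fun hw => absurd (Finset.mem_univ u) hw
  have h2 : stateBelief (G.beliefUpdate b a (G.outcome i u) o) u' =
      c * (∑ y, (G.stateKernel i y u a u').toReal * b (u, y)) / N := by
    simp only [stateBelief, h1, ← Finset.sum_div, ← Finset.mul_sum]
  have h3 := h
  rw [h2] at h3
  have hN0 : N ≠ 0 := fun e => h3 (by rw [e, div_zero])
  have hc0 : c ≠ 0 := fun e => h3 (by rw [e, zero_mul, zero_div])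
  have hS0 : stateBelief b u ≠ 0 := by
    intro e
    refine h3 ?_
    simp [eq_zero_of_stateBelief_eq_zero hb e]
  funext y
  have h4 : ∑ y', (G.stateKernel i y' u a u').toReal * typeBelief b u y' =
      (∑ y', (G.stateKernel i y' u a u').toReal * b (u, y')) / stateBelief b u := by
    simp only [typeBelief, ← mul_div_assoc, ← Finset.sum_div]
  rw [typeBelief, h2, h1, typeBeliefUpdate, h4, typeBelief, div_div_div_cancel_right₀ hN0,
    mul_div_mul_left _ _ hc0, ← mul_div_assoc, div_div_div_cancel_right₀ hS0]

/-! ### The Bellman operator on beliefs -/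

variable [Fintype O] [Fintype Z]

/-- Every past state has exactly one outcome, so summing over `z` removes the indicator. This links
sums over signals to the dynamics of the process; `f = 1` gives the total signal probability. -/
theorem sum_jointProb_mul (b : U × OtherTypes Y i → ℝ) (a : A i)
    (f : U × OtherTypes Y i → Z → O → ℝ) :
    ∑ z, ∑ o, ∑ s, G.jointProb b a z o s * f s z o =
      ∑ s, b s * ∑ u', (G.stateKernel i s.2 s.1 a u').toReal *
        ∑ o, (G.observation i a u' o).toReal * f (u', s.2) (G.outcome i s.1) o := by
  classical
  have h1 : ∀ z, ∑ o, ∑ s, G.jointProb b a z o s * f s z o =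
      ∑ u, if G.outcome i u = z then ∑ y, ∑ u', ∑ o, (G.observation i a u' o).toReal *
        ((G.stateKernel i y u a u').toReal * b (u, y)) * f (u', y) z o else 0 := by
    intro z
    simp only [Fintype.sum_prod_type, jointProb, Finset.mul_sum, Finset.sum_mul]
    rw [Finset.sum_reverse₄]
    refine Finset.sum_congr rfl fun u _ => ?_
    split_ifs with h
    · simp
    · simp
  simp only [h1]
  rw [Finset.sum_comm]
  simp only [Finset.sum_ite_eq, Finset.mem_univ, if_true, Fintype.sum_prod_type, Finset.mul_sum]
  refine Finset.sum_congr rfl fun u _ => Finset.sum_congr rfl fun y _ =>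
    Finset.sum_congr rfl fun u' _ => Finset.sum_congr rfl fun o _ => ?_
  ring

theorem sum_signalProb (b : U × OtherTypes Y i → ℝ) (a : A i) :
    ∑ z, ∑ o, G.signalProb b a z o = ∑ s, b s := by
  have := G.sum_jointProb_mul b a fun _ _ _ => 1
  simp only [signalProb]
  simpa only [mul_one, PMF.sum_toReal] using this

theorem abs_sum_signalProb_mul_le {b : U × OtherTypes Y i → ℝ}
    (hb : b ∈ stdSimplex ℝ (U × OtherTypes Y i)) (a : A i) {w : (U × OtherTypes Y i → ℝ) → ℝ}
    {D : ℝ} (hw : ∀ b ∈ stdSimplex ℝ (U × OtherTypes Y i), |w b| ≤ D) :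
    |∑ z, ∑ o, G.signalProb b a z o * w (G.beliefUpdate b a z o)| ≤ D := by
  have h1 : ∀ z o, |G.signalProb b a z o * w (G.beliefUpdate b a z o)| ≤
      G.signalProb b a z o * D := by
    intro z o
    rw [abs_mul, abs_of_nonneg (G.signalProb_nonneg hb.1 a z o)]
    by_cases h : G.signalProb b a z o = 0
    · simp [h]
    · exact mul_le_mul_of_nonneg_left (hw _ (G.beliefUpdate_mem_stdSimplex hb.1 h))
        (G.signalProb_nonneg hb.1 a z o)
  calc _ ≤ ∑ z, |∑ o, G.signalProb b a z o * w (G.beliefUpdate b a z o)| :=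
        Finset.abs_sum_le_sum_abs _ _
    _ ≤ ∑ z, ∑ o, |G.signalProb b a z o * w (G.beliefUpdate b a z o)| :=
        Finset.sum_le_sum fun z _ => Finset.abs_sum_le_sum_abs _ _
    _ ≤ ∑ z, ∑ o, G.signalProb b a z o * D :=
        Finset.sum_le_sum fun z _ => Finset.sum_le_sum fun o _ => h1 z o
    _ = D := by simp only [← Finset.sum_mul, sum_signalProb, hb.2, one_mul]

theorem actionValue_eq {b : U × OtherTypes Y i → ℝ} (hb : ∀ s, 0 ≤ b s) (γ : ℝ)
    (v : (U × OtherTypes Y i → ℝ) → ℝ) (a : A i) :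
    G.actionValue γ v b a = ∑ s, b s * G.slotReward i s.2 s.1 a +
      γ * ∑ z, ∑ o, G.signalProb b a z o * v (G.beliefUpdate b a z o) := by
  simp only [actionValue, stateBelief_mul_typeBelief hb, Fintype.sum_prod_type]

theorem abs_actionValue_le {C D γ : ℝ} (hC : ∀ u a, |G.reward i u a| ≤ C) (hC₀ : 0 ≤ C)
    (hγ₀ : 0 ≤ γ) {b : U × OtherTypes Y i → ℝ} (hb : b ∈ stdSimplex ℝ (U × OtherTypes Y i))
    {v : (U × OtherTypes Y i → ℝ) → ℝ}
    (hv : ∀ b ∈ stdSimplex ℝ (U × OtherTypes Y i), |v b| ≤ D) (a : A i) :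
    |G.actionValue γ v b a| ≤ C + γ * D := by
  rw [G.actionValue_eq hb.1]
  refine (abs_add_le _ _).trans (add_le_add ?_ ?_)
  · exact abs_sum_mul_le hC₀ hb.1 hb.2.le fun s => abs_slotReward_le hC _ _ _
  · rw [abs_mul, abs_of_nonneg hγ₀]
    exact mul_le_mul_of_nonneg_left (G.abs_sum_signalProb_mul_le hb a hv) hγ₀

theorem abs_actionValue_sub_le {D γ : ℝ} (hγ₀ : 0 ≤ γ) {b : U × OtherTypes Y i → ℝ}
    (hb : b ∈ stdSimplex ℝ (U × OtherTypes Y i)) {v v' : (U × OtherTypes Y i → ℝ) → ℝ}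
    (hv : ∀ b ∈ stdSimplex ℝ (U × OtherTypes Y i), |v b - v' b| ≤ D) (a : A i) :
    |G.actionValue γ v b a - G.actionValue γ v' b a| ≤ γ * D := by
  have := G.abs_sum_signalProb_mul_le hb a hv
  rw [G.actionValue_eq hb.1, G.actionValue_eq hb.1, add_sub_add_left_eq_sub, ← mul_sub,
    ← Finset.sum_sub_distrib, abs_mul, abs_of_nonneg hγ₀]
  simp only [← Finset.sum_sub_distrib, ← mul_sub]
  exact mul_le_mul_of_nonneg_left this hγ₀

/-- A signal whose update leaves the simplex has probability zero, so the values of `v` outside the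
simplex carry no weight. -/
theorem actionValue_congr {b : U × OtherTypes Y i → ℝ}
    (hb : b ∈ stdSimplex ℝ (U × OtherTypes Y i)) (γ : ℝ) {v v' : (U × OtherTypes Y i → ℝ) → ℝ}
    (hv : Set.EqOn v v' (stdSimplex ℝ (U × OtherTypes Y i))) (a : A i) :
    G.actionValue γ v b a = G.actionValue γ v' b a := by
  rw [actionValue, actionValue]
  congr 2
  refine Finset.sum_congr rfl fun z _ => Finset.sum_congr rfl fun o _ => ?_
  by_cases h : G.signalProb b a z o = 0
  · rw [h, zero_mul, zero_mul]
  · rw [hv (G.beliefUpdate_mem_stdSimplex hb.1 h)]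

/-! ### The Bellman equation -/

variable {G}

/-- Applying the contraction estimate `n` times bounds the difference by `γ ^ n` times the initial
bound. -/
theorem IsBellmanSolution.eqOn {γ : ℝ} (hγ₀ : 0 ≤ γ) (hγ₁ : γ < 1)
    {v v' : (U × OtherTypes Y i → ℝ) → ℝ} (hv : G.IsBellmanSolution γ v)
    (hv' : G.IsBellmanSolution γ v') : Set.EqOn v v' (stdSimplex ℝ (U × OtherTypes Y i)) := by
  obtain ⟨⟨C, hC⟩, hL⟩ := hv
  obtain ⟨⟨C', hC'⟩, hL'⟩ := hv'
  have h : ∀ n : ℕ, ∀ b ∈ stdSimplex ℝ (U × OtherTypes Y i), |v b - v' b| ≤ γ ^ n * (C + C') := by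
    intro n
    induction n with
    | zero =>
      intro b hb
      rw [pow_zero, one_mul]
      exact (abs_sub _ _).trans (add_le_add (hC b hb) (hC' b hb))
    | succ n ih =>
      intro b hb
      rw [pow_succ', mul_assoc]
      exact abs_sub_le_of_isLUB_range (hL b hb) (hL' b hb) (G.abs_actionValue_sub_le hγ₀ hb ih)
  intro b hb
  have h0 : Tendsto (fun n : ℕ => γ ^ n * (C + C')) atTop (𝓝 (0 * (C + C'))) :=
    (tendsto_pow_atTop_nhds_zero_of_lt_one hγ₀ hγ₁).mul_const _
  rw [zero_mul] at h0
  have := ge_of_tendsto' h0 fun n => h n b hb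
  exact sub_eq_zero.1 (abs_nonpos_iff.1 this)

variable (G) in
theorem exists_isBellmanSolution [Nonempty (A i)] (hreward : ∃ C : ℝ, ∀ u a, |G.reward i u a| ≤ C)
    {γ : ℝ} (hγ₀ : 0 ≤ γ) (hγ₁ : γ < 1) :
    ∃ v : (U × OtherTypes Y i → ℝ) → ℝ, G.IsBellmanSolution γ v := by
  classical
  obtain ⟨C, hC₀, hC⟩ : ∃ C : ℝ, 0 ≤ C ∧ ∀ u a, |G.reward i u a| ≤ C := by
    obtain ⟨C, hC⟩ := hreward
    exact ⟨|C|, abs_nonneg C, fun u a => (hC u a).trans (le_abs_self C)⟩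
  -- The fixed point is sought among bounded functions on the simplex; extension by zero makes them
  -- arguments of `actionValue`.
  let ext : (stdSimplex ℝ (U × OtherTypes Y i) → ℝ) → (U × OtherTypes Y i → ℝ) → ℝ :=
    fun f b => if h : b ∈ stdSimplex ℝ (U × OtherTypes Y i) then f ⟨b, h⟩ else 0
  have hext : ∀ f b (hb : b ∈ stdSimplex ℝ (U × OtherTypes Y i)), ext f b = f ⟨b, hb⟩ :=
    fun f b hb => dif_pos hb
  have hval : ∀ f D, (∀ x, |f x| ≤ D) → ∀ (b : stdSimplex ℝ (U × OtherTypes Y i)) (a : A i),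
      |G.actionValue γ (ext f) b a| ≤ C + γ * D := fun f D hf b =>
    G.abs_actionValue_le hC hC₀ hγ₀ b.2 fun b' hb' => by rw [hext f b' hb']; exact hf _
  -- A real `⨆` is a least upper bound only for a nonempty family that is bounded above;
  -- nonemptiness of `A i` and `hval` provide this.
  have hlub : ∀ f, (∃ D, ∀ x, |f x| ≤ D) → ∀ b : stdSimplex ℝ (U × OtherTypes Y i),
      IsLUB (Set.range fun a : A i => G.actionValue γ (ext f) b a)
        (⨆ a, G.actionValue γ (ext f) b a) := by
    rintro f ⟨D, hD⟩ b
    refine isLUB_ciSup ⟨C + γ * D, ?_⟩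
    rintro _ ⟨a, rfl⟩
    exact (abs_le.1 (hval f D hD b a)).2
  obtain ⟨f, hf, hfix⟩ := exists_bounded_fixedPoint hγ₀ hγ₁
    (fun f (b : stdSimplex ℝ (U × OtherTypes Y i)) => ⨆ a : A i, G.actionValue γ (ext f) b a)
    (fun f D hD => ⟨C + γ * D, fun b => by
      obtain ⟨a⟩ := ‹Nonempty (A i)›
      have hl := hlub f ⟨D, hD⟩ b
      refine abs_le.2 ⟨((abs_le.1 (hval f D hD b a)).1).trans (hl.1 ⟨a, rfl⟩), hl.2 ?_⟩
      rintro _ ⟨a', rfl⟩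
      exact (abs_le.1 (hval f D hD b a')).2⟩)
    (fun f g D _ hf hg hfg b => abs_sub_le_of_isLUB_range (hlub f hf b) (hlub g hg b)
      (G.abs_actionValue_sub_le hγ₀ b.2 fun b' hb' => by
        rw [hext f b' hb', hext g b' hb']; exact hfg _))
  refine ⟨ext f, ?_, fun b hb => ?_⟩
  · obtain ⟨D, hD⟩ := hf
    exact ⟨D, fun b hb => by rw [hext f b hb]; exact hD _⟩
  · have hfb : (⨆ a, G.actionValue γ (ext f) (⟨b, hb⟩ : stdSimplex ℝ (U × OtherTypes Y i)) a) =
        f ⟨b, hb⟩ := congrFun hfix ⟨b, hb⟩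
    rw [hext f b hb, ← hfb]
    exact hlub f hf ⟨b, hb⟩

theorem exists_isMaximizing [Nonempty (A i)] [Finite (A i)] (γ : ℝ)
    (v : (U × OtherTypes Y i → ℝ) → ℝ) :
    ∃ d : (U × OtherTypes Y i → ℝ) → A i, G.IsMaximizing γ v d := by
  choose d hd using fun b => Finite.exists_max fun a : A i => G.actionValue γ v b a
  exact ⟨d, fun b _ a => hd b a⟩

theorem IsBellmanSolution.apply_eq {γ : ℝ} {v : (U × OtherTypes Y i → ℝ) → ℝ}
    (hv : G.IsBellmanSolution γ v) {d : (U × OtherTypes Y i → ℝ) → A i}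
    (hd : G.IsMaximizing γ v d) {b : U × OtherTypes Y i → ℝ}
    (hb : b ∈ stdSimplex ℝ (U × OtherTypes Y i)) : G.actionValue γ v b (d b) = v b := by
  refine le_antisymm ((hv.2 b hb).1 ⟨d b, rfl⟩) ((hv.2 b hb).2 ?_)
  rintro _ ⟨a, rfl⟩
  exact hd b hb a

end FogGame

/-! ### Optimality of maximizing policies -/

namespace FogGame

variable {F : Type*} [DecidableEq F] {Y A : F → Type*} {U O Z : Type*}

section BeliefAfter

variable [Fintype F] [∀ j, Fintype (Y j)] [Fintype U] {i : F} (G : FogGame F Y A U O Z)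

/-- A signal of probability zero makes the update divide by zero and return the zero function. The
later estimates are proved for every past, so this case has to be carried along. -/
theorem beliefAfter_mem_or_eq_zero {b : U × OtherTypes Y i → ℝ}
    (hb : b ∈ stdSimplex ℝ (U × OtherTypes Y i)) (k : List (Z × A i × O)) :
    G.beliefAfter b k ∈ stdSimplex ℝ (U × OtherTypes Y i) ∨ G.beliefAfter b k = 0 := by
  induction k with
  | nil => exact Or.inl hb
  | cons e k ih =>
    by_cases h : G.signalProb (G.beliefAfter b k) e.2.1 e.1 e.2.2 = 0
    · refine Or.inr (funext fun s => ?_)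
      simp only [beliefAfter, beliefUpdate, h, div_zero, Pi.zero_apply]
    · refine Or.inl (G.beliefUpdate_mem_stdSimplex ?_ h)
      rcases ih with ih | ih
      · exact ih.1
      · simp [ih]

theorem beliefAfter_nonneg {b : U × OtherTypes Y i → ℝ}
    (hb : b ∈ stdSimplex ℝ (U × OtherTypes Y i)) (k : List (Z × A i × O))
    (s : U × OtherTypes Y i) : 0 ≤ G.beliefAfter b k s := by
  rcases G.beliefAfter_mem_or_eq_zero hb k with h | h
  · exact h.1 s
  · simp [h]

theorem sum_beliefAfter_le_one {b : U × OtherTypes Y i → ℝ}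
    (hb : b ∈ stdSimplex ℝ (U × OtherTypes Y i)) (k : List (Z × A i × O)) :
    ∑ s, G.beliefAfter b k s ≤ 1 := by
  rcases G.beliefAfter_mem_or_eq_zero hb k with h | h
  · exact h.2.le
  · simp [h]

theorem toReal_mem_stdSimplex (p : PMF (U × OtherTypes Y i)) :
    (fun s => (p s).toReal) ∈ stdSimplex ℝ (U × OtherTypes Y i) :=
  ⟨fun _ => ENNReal.toReal_nonneg, p.sum_toReal⟩

theorem abs_sum_beliefAfter_mul_le
    {f : U × OtherTypes Y i → List (Z × A i × O) → ℝ} {C : ℝ} {b : U × OtherTypes Y i → ℝ}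
    (hb : b ∈ stdSimplex ℝ (U × OtherTypes Y i)) (hC : 0 ≤ C) (hf : ∀ s k, |f s k| ≤ C)
    (k : List (Z × A i × O)) : |∑ s, G.beliefAfter b k s * f s k| ≤ C :=
  abs_sum_mul_le hC (G.beliefAfter_nonneg hb k) (G.sum_beliefAfter_le_one hb k) fun s => hf s k

end BeliefAfter

/-- What node `i` sees of the past. -/
def visible (G : FogGame F Y A U O Z) (i : F) (h : List (U × A i × O)) : List (Z × A i × O) :=
  h.map fun e => (G.outcome i e.1, e.2.1, e.2.2)

variable {i : F} (G : FogGame F Y A U O Z)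

theorem abs_meanReward_le (π : Policy A O Z i) (b₀ : PMF (U × OtherTypes Y i))
    {C : ℝ} (hreward : ∀ u a, |G.reward i u a| ≤ C) (t : ℕ) : |G.meanReward i π b₀ t| ≤ C :=
  abs_expect_le _ fun x => hreward x.1 x.2

variable [Fintype U] [Fintype O]

/-- Expectation, given the physical state and types `s` and the visible past `k`, of a function of
the data at the beginning of the next slot. -/
noncomputable def nextExpect (π : Policy A O Z i)
    (f : U × OtherTypes Y i → List (Z × A i × O) → ℝ) (s : U × OtherTypes Y i)
    (k : List (Z × A i × O)) : ℝ :=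
  expect (π k) fun a => ∑ u', (G.stateKernel i s.2 s.1 a u').toReal *
    ∑ o, (G.observation i a u' o).toReal * f (u', s.2) ((G.outcome i s.1, a, o) :: k)

variable {f : U × OtherTypes Y i → List (Z × A i × O) → ℝ} {C : ℝ}

theorem abs_sum_stateKernel_le (hC : 0 ≤ C) (hf : ∀ s k, |f s k| ≤ C) (s : U × OtherTypes Y i)
    (k : List (Z × A i × O)) (a : A i) :
    |∑ u', (G.stateKernel i s.2 s.1 a u').toReal *
      ∑ o, (G.observation i a u' o).toReal * f (u', s.2) ((G.outcome i s.1, a, o) :: k)| ≤ C :=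
  abs_sum_mul_le hC (fun _ => ENNReal.toReal_nonneg) (PMF.sum_toReal _).le fun _ =>
    abs_sum_mul_le hC (fun _ => ENNReal.toReal_nonneg) (PMF.sum_toReal _).le fun _ => hf _ _

theorem abs_nextExpect_le (π : Policy A O Z i) (hC : 0 ≤ C) (hf : ∀ s k, |f s k| ≤ C)
    (s : U × OtherTypes Y i) (k : List (Z × A i × O)) : |G.nextExpect π f s k| ≤ C :=
  abs_expect_le _ fun a => G.abs_sum_stateKernel_le hC hf s k a

theorem expect_runLaw_succ (π : Policy A O Z i) (init : PMF (U × OtherTypes Y i)) (t : ℕ)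
    (hf : ∀ s k, |f s k| ≤ C) :
    expect (G.runLaw i (π.behaviour G) init (t + 1)) (fun r => f r.1 (G.visible i r.2)) =
      expect (G.runLaw i (π.behaviour G) init t)
        fun r => G.nextExpect π f r.1 (G.visible i r.2) := by
  have hf' : ∀ r : (U × OtherTypes Y i) × List (U × A i × O), |f r.1 (G.visible i r.2)| ≤ C :=
    fun _ => hf _ _
  rw [runLaw, expect_bind _ _ hf']
  refine congrArg (expect _) (funext fun r => ?_)
  rw [expect_bind _ _ hf']
  refine congrArg (expect _) (funext fun a => ?_)
  rw [expect_bind _ _ hf', expect_fintype]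
  refine Finset.sum_congr rfl fun u' _ => ?_
  rw [expect_map _ _ hf', expect_fintype]
  rfl

variable [Fintype F] [∀ j, Fintype (Y j)]

variable [Fintype Z]

theorem sum_mul_nextExpect (π : Policy A O Z i) (hC : 0 ≤ C) (hf : ∀ s k, |f s k| ≤ C)
    (b : U × OtherTypes Y i → ℝ) (k : List (Z × A i × O)) :
    ∑ s, b s * G.nextExpect π f s k =
      expect (π k) fun a => ∑ z, ∑ o, ∑ s, G.jointProb b a z o s * f s ((z, a, o) :: k) := by
  simp only [G.sum_jointProb_mul b _ fun s z o => f s ((z, _, o) :: k), nextExpect]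
  exact sum_mul_expect (π k) b fun s a => G.abs_sum_stateKernel_le hC hf s k a

/-- The belief after the visible past is the conditional law of physical state and types. -/
theorem expect_runLaw_eq_expect_belief (π : Policy A O Z i) (b₀ : PMF (U × OtherTypes Y i))
    (hC : 0 ≤ C) (hf : ∀ s k, |f s k| ≤ C) (t : ℕ) :
    expect (G.runLaw i (π.behaviour G) b₀ t) (fun r => f r.1 (G.visible i r.2)) =
      expect (G.runLaw i (π.behaviour G) b₀ t) fun r =>
        ∑ s, G.beliefAfter (fun s => (b₀ s).toReal) (G.visible i r.2) s *
          f s (G.visible i r.2) := by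
  have hb := toReal_mem_stdSimplex b₀
  induction t generalizing f with
  | zero =>
    have h1 : ∀ r : (U × OtherTypes Y i) × List (U × A i × O), |f r.1 (G.visible i r.2)| ≤ C :=
      fun _ => hf _ _
    have h2 : ∀ r : (U × OtherTypes Y i) × List (U × A i × O),
        |∑ s, G.beliefAfter (fun s => (b₀ s).toReal) (G.visible i r.2) s *
          f s (G.visible i r.2)| ≤ C :=
      fun r => G.abs_sum_beliefAfter_mul_le hb hC hf (G.visible i r.2)
    rw [runLaw, expect_map _ _ h1, expect_map _ _ h2, expect_fintype]
    exact (expect_const _ _).symm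
  | succ t ih =>
    set B := G.beliefAfter fun s => (b₀ s).toReal with hB
    have hf' : ∀ (s : U × OtherTypes Y i) k, |∑ s, B k s * f s k| ≤ C := fun _ k =>
      G.abs_sum_beliefAfter_mul_le hb hC hf k
    -- Both sides are moved back one slot, and the induction hypothesis is applied to each of the
    -- two resulting functions. What remains is an identity for each visible past.
    rw [G.expect_runLaw_succ π b₀ t hf, G.expect_runLaw_succ (f := fun _ k => ∑ s, B k s * f s k)
      π b₀ t hf', ih (G.abs_nextExpect_le π hC hf), ih (G.abs_nextExpect_le π hC hf')]
    refine congrArg (expect _) (funext fun r => ?_)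
    rw [G.sum_mul_nextExpect π hC hf, G.sum_mul_nextExpect π hC hf']
    refine congrArg (expect _) (funext fun a => Finset.sum_congr rfl fun z _ =>
      Finset.sum_congr rfl fun o _ => ?_)
    have hn := G.beliefAfter_nonneg hb (G.visible i r.2)
    -- The averaged function does not depend on the state and types, so `jointProb` sums to
    -- `signalProb`, which then cancels the denominator of the update.
    rw [← Finset.sum_mul, ← signalProb, Finset.mul_sum]
    refine Finset.sum_congr rfl fun s _ => ?_
    rw [← G.signalProb_mul_beliefUpdate hn, mul_assoc]
    rfl

theorem meanReward_eq (π : Policy A O Z i) (b₀ : PMF (U × OtherTypes Y i)) (hC : 0 ≤ C)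
    (hreward : ∀ u a, |G.reward i u a| ≤ C) (t : ℕ) :
    G.meanReward i π b₀ t =
      expect (G.runLaw i (π.behaviour G) b₀ t) fun r => expect (π (G.visible i r.2)) fun a =>
        ∑ s, G.beliefAfter (fun s => (b₀ s).toReal) (G.visible i r.2) s *
          G.slotReward i s.2 s.1 a := by
  have hx : ∀ x : U × (∀ j, A j), |G.reward i x.1 x.2| ≤ C := fun x => hreward x.1 x.2
  have h1 : G.meanReward i π b₀ t = expect (G.runLaw i (π.behaviour G) b₀ t) fun r =>
      expect (π (G.visible i r.2)) fun a => G.slotReward i r.1.2 r.1.1 a := by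
    rw [meanReward, expect_bind _ _ hx]
    refine congrArg (expect _) (funext fun r => ?_)
    rw [expect_bind _ _ hx]
    refine congrArg (expect _) (funext fun a => ?_)
    rw [expect_map _ _ hx]
    rfl
  rw [h1, G.expect_runLaw_eq_expect_belief (f := fun s k => expect (π k) fun a =>
    G.slotReward i s.2 s.1 a) π b₀ hC fun s k => abs_expect_le _ fun a =>
      abs_slotReward_le hreward _ _ _]
  refine congrArg (expect _) (funext fun r => ?_)
  exact sum_mul_expect _ _ fun s a => abs_slotReward_le hreward _ _ _

theorem expect_runLaw_succ_belief (π : Policy A O Z i) (b₀ : PMF (U × OtherTypes Y i)) {D : ℝ}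
    (hD : 0 ≤ D) {v : (U × OtherTypes Y i → ℝ) → ℝ} (hv : ∀ b, |v b| ≤ D) (t : ℕ) :
    expect (G.runLaw i (π.behaviour G) b₀ (t + 1)) (fun r =>
        v (G.beliefAfter (fun s => (b₀ s).toReal) (G.visible i r.2))) =
      expect (G.runLaw i (π.behaviour G) b₀ t) fun r => expect (π (G.visible i r.2)) fun a =>
        ∑ z, ∑ o, G.signalProb (G.beliefAfter (fun s => (b₀ s).toReal) (G.visible i r.2)) a z o *
          v (G.beliefUpdate (G.beliefAfter (fun s => (b₀ s).toReal) (G.visible i r.2)) a z o) := by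
  have hv' : ∀ (s : U × OtherTypes Y i) k, |v (G.beliefAfter (fun s => (b₀ s).toReal) k)| ≤ D :=
    fun _ _ => hv _
  rw [G.expect_runLaw_succ (f := fun _ k => v (G.beliefAfter (fun s => (b₀ s).toReal) k)) π b₀ t
    hv', G.expect_runLaw_eq_expect_belief π b₀ hD (G.abs_nextExpect_le π hD hv')]
  refine congrArg (expect _) (funext fun r => ?_)
  rw [G.sum_mul_nextExpect π hD hv']
  simp only [← Finset.sum_mul]
  rfl

/-! ### Verification of the maximizing policy -/

theorem actionValue_zero (γ : ℝ) (v : (U × OtherTypes Y i → ℝ) → ℝ) (a : A i) :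
    G.actionValue γ v 0 a = 0 := by
  rw [G.actionValue_eq (b := 0) fun _ => le_rfl]
  simp [signalProb, jointProb]

theorem abs_actionValue_beliefAfter_le {D γ : ℝ} (hreward : ∀ u a, |G.reward i u a| ≤ C)
    (hC : 0 ≤ C) (hγ₀ : 0 ≤ γ) (hD : 0 ≤ D) {v : (U × OtherTypes Y i → ℝ) → ℝ}
    (hv : ∀ b, |v b| ≤ D) {b : U × OtherTypes Y i → ℝ}
    (hb : b ∈ stdSimplex ℝ (U × OtherTypes Y i)) (k : List (Z × A i × O)) (a : A i) :
    |G.actionValue γ v (G.beliefAfter b k) a| ≤ C + γ * D := by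
  rcases G.beliefAfter_mem_or_eq_zero hb k with h | h
  · exact G.abs_actionValue_le hreward hC hγ₀ h (fun b _ => hv b) a
  · rw [h, actionValue_zero, abs_zero]
    positivity

/-- The dynamic programming identity for an arbitrary policy and bounded `v`; the Bellman equation
enters only later, when `actionValue` is compared with `v`. -/
theorem meanReward_add_eq (π : Policy A O Z i) (b₀ : PMF (U × OtherTypes Y i)) {D γ : ℝ}
    (hreward : ∀ u a, |G.reward i u a| ≤ C) (hC : 0 ≤ C) (hD : 0 ≤ D)
    {v : (U × OtherTypes Y i → ℝ) → ℝ} (hv : ∀ b, |v b| ≤ D) (t : ℕ) :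
    G.meanReward i π b₀ t + γ * expect (G.runLaw i (π.behaviour G) b₀ (t + 1)) (fun r =>
        v (G.beliefAfter (fun s => (b₀ s).toReal) (G.visible i r.2))) =
      expect (G.runLaw i (π.behaviour G) b₀ t) fun r => expect (π (G.visible i r.2)) fun a =>
        G.actionValue γ v (G.beliefAfter (fun s => (b₀ s).toReal) (G.visible i r.2)) a := by
  have hb := toReal_mem_stdSimplex b₀
  set B := G.beliefAfter fun s => (b₀ s).toReal with hB
  let R : List (Z × A i × O) → A i → ℝ := fun k a => ∑ s, B k s * G.slotReward i s.2 s.1 a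
  let N : List (Z × A i × O) → A i → ℝ := fun k a =>
    ∑ z, ∑ o, G.signalProb (B k) a z o * v (G.beliefUpdate (B k) a z o)
  have hR : ∀ k a, |R k a| ≤ C := fun k a =>
    G.abs_sum_beliefAfter_mul_le (f := fun s _ => G.slotReward i s.2 s.1 a) hb hC
      (fun s _ => abs_slotReward_le hreward _ _ _) k
  have hN : ∀ k a, |N k a| ≤ D := by
    intro k a
    rcases G.beliefAfter_mem_or_eq_zero hb k with h | h
    · exact G.abs_sum_signalProb_mul_le h a fun b _ => hv b
    · have : N k a = 0 := by simp [N, hB, h, signalProb, jointProb]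
      rwa [this, abs_zero]
  have hγN : ∀ k a, |γ * N k a| ≤ |γ| * D := fun k a => by
    rw [abs_mul]
    exact mul_le_mul_of_nonneg_left (hN k a) (abs_nonneg _)
  have hval : ∀ k, G.actionValue γ v (B k) = fun a => R k a + γ * N k a := fun k =>
    funext fun a => G.actionValue_eq (G.beliefAfter_nonneg hb k) γ v a
  set L := G.runLaw i (π.behaviour G) b₀ t
  calc _ = expect L (fun r => expect (π (G.visible i r.2)) (R (G.visible i r.2))) +
        γ * expect L (fun r => expect (π (G.visible i r.2)) (N (G.visible i r.2))) :=
        congrArg₂ (fun x y => x + γ * y) (G.meanReward_eq π b₀ hC hreward t)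
          (G.expect_runLaw_succ_belief π b₀ hD hv t)
    _ = expect L fun r => expect (π (G.visible i r.2)) (R (G.visible i r.2)) +
        expect (π (G.visible i r.2)) (fun a => γ * N (G.visible i r.2) a) := by
        rw [← expect_const_mul, ← expect_add L (fun r => abs_expect_le _ (hR _))
          (D := |γ| * D)]
        · simp only [expect_const_mul]
        · intro r
          rw [← expect_const_mul]
          exact abs_expect_le _ (hγN _)
    _ = _ := by
        refine congrArg (expect _) (funext fun r => ?_)
        rw [← expect_add _ (hR _) (hγN _)]
        exact congrArg (expect _) (hval _).symm

variable {G}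

theorem IsBellmanSolution.longTermReward {γ : ℝ} (hγ₀ : 0 ≤ γ) (hγ₁ : γ < 1)
    (hreward : ∃ C : ℝ, ∀ u a, |G.reward i u a| ≤ C)
    {v : (U × OtherTypes Y i → ℝ) → ℝ} (hv : G.IsBellmanSolution γ v)
    {d : (U × OtherTypes Y i → ℝ) → A i} (hd : G.IsMaximizing γ v d)
    (b₀ : PMF (U × OtherTypes Y i)) :
    G.longTermReward i γ (G.beliefPolicy d fun s => (b₀ s).toReal) b₀ =
        v (fun s => (b₀ s).toReal) ∧
      ∀ π : Policy A O Z i, G.longTermReward i γ π b₀ ≤ v (fun s => (b₀ s).toReal) := by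
  classical
  obtain ⟨C, hC, hreward⟩ : ∃ C : ℝ, 0 ≤ C ∧ ∀ u a, |G.reward i u a| ≤ C := by
    obtain ⟨C, hC⟩ := hreward
    exact ⟨|C|, abs_nonneg C, fun u a => (hC u a).trans (le_abs_self C)⟩
  have hb := toReal_mem_stdSimplex b₀
  -- Setting `v` to zero off the simplex makes it bounded everywhere and gives it at the zero belief
  -- the value of `actionValue` there, so the Bellman comparison extends to impossible pasts.
  obtain ⟨v', hvv', hv'0⟩ : ∃ v' : (U × OtherTypes Y i → ℝ) → ℝ,
      Set.EqOn v v' (stdSimplex ℝ (U × OtherTypes Y i)) ∧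
      ∀ b ∉ stdSimplex ℝ (U × OtherTypes Y i), v' b = 0 :=
    ⟨(stdSimplex ℝ (U × OtherTypes Y i)).indicator v,
      fun b hb => (Set.indicator_of_mem hb v).symm, fun b hb => Set.indicator_of_notMem hb v⟩
  obtain ⟨D, hD, hvD⟩ : ∃ D, 0 ≤ D ∧ ∀ b, |v' b| ≤ D := by
    obtain ⟨D, hD⟩ := hv.1
    refine ⟨|D|, abs_nonneg D, fun b => ?_⟩
    by_cases hb : b ∈ stdSimplex ℝ (U × OtherTypes Y i)
    · rw [← hvv' hb]
      exact (hD b hb).trans (le_abs_self D)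
    · rw [hv'0 b hb, abs_zero]
      exact abs_nonneg D
  set B := G.beliefAfter fun s => (b₀ s).toReal with hB
  have hzero : v' 0 = 0 := hv'0 0 fun h => zero_ne_one ((by simp : (0 : ℝ) = _).trans h.2)
  have hle : ∀ k a, G.actionValue γ v' (B k) a ≤ v' (B k) := by
    intro k a
    rcases G.beliefAfter_mem_or_eq_zero hb k with h | h
    · rw [← G.actionValue_congr h γ hvv', ← hvv' h]
      exact (hv.2 _ h).1 ⟨a, rfl⟩
    · rw [hB, h, actionValue_zero, hzero]
  have heq : ∀ k, G.actionValue γ v' (B k) (d (B k)) = v' (B k) := by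
    intro k
    rcases G.beliefAfter_mem_or_eq_zero hb k with h | h
    · rw [← G.actionValue_congr h γ hvv', ← hvv' h]
      exact hv.apply_eq hd h
    · rw [hB, h, actionValue_zero, hzero]
  have hstart : ∀ π : Policy A O Z i, expect (G.runLaw i (π.behaviour G) b₀ 0) (fun r =>
      v' (B (G.visible i r.2))) = v (fun s => (b₀ s).toReal) := by
    intro π
    rw [runLaw, expect_map _ _ fun _ => hvD _, hvv' hb]
    exact expect_const b₀ (v' fun s => (b₀ s).toReal)
  have hbound : ∀ k a, |G.actionValue γ v' (B k) a| ≤ C + γ * D := fun k a =>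
    G.abs_actionValue_beliefAfter_le hreward hC hγ₀ hD hvD hb k a
  constructor
  · rw [FogGame.longTermReward, ← hstart (G.beliefPolicy d fun s => (b₀ s).toReal)]
    refine tsum_discounted_eq hγ₀ hγ₁ (V := fun t => expect
      (G.runLaw i ((G.beliefPolicy d fun s => (b₀ s).toReal).behaviour G) b₀ t) fun r =>
        v' (B (G.visible i r.2))) (G.abs_meanReward_le _ b₀ hreward)
      (fun t => abs_expect_le _ fun _ => hvD _) fun t => ?_
    rw [G.meanReward_add_eq _ b₀ hreward hC hD hvD]
    refine congrArg (expect _) (funext fun r => ?_)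
    rw [beliefPolicy, expect_pure]
    exact heq _
  · intro π
    rw [FogGame.longTermReward, ← hstart π]
    refine tsum_discounted_le hγ₀ hγ₁ (V := fun t => expect
      (G.runLaw i (π.behaviour G) b₀ t) fun r => v' (B (G.visible i r.2)))
      (G.abs_meanReward_le _ b₀ hreward) (fun t => abs_expect_le _ fun _ => hvD _) fun t => ?_
    rw [G.meanReward_add_eq _ b₀ hreward hC hD hvD]
    refine expect_mono _ (fun r => abs_expect_le _ (hbound _)) (fun _ => hvD _) fun r => ?_
    -- A randomized action averages values none of which exceeds `v'` at the present belief.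
    rw [← expect_const (π (G.visible i r.2)) (v' _)]
    exact expect_mono _ (hbound _) (fun _ => hvD _) (hle _)

end FogGame

theorem theorem2 {F : Type*} [Fintype F] [DecidableEq F] {Y A : F → Type*} {U O Z : Type*}
    [∀ j, Fintype (Y j)] [∀ j, Nonempty (A j)] [Fintype U] [Fintype O] [Fintype Z]
    (G : FogGame F Y A U O Z) (i : F)
    (hreward : ∃ C : ℝ, ∀ u a, |G.reward i u a| ≤ C)
    (γ : ℝ) (hγ₀ : 0 ≤ γ) (hγ₁ : γ < 1) :
    -- the belief about types converges to a stationary distribution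
    (∀ (prior : PMF (OtherTypes Y i)) (y : OtherTypes Y i) (_ : prior y ≠ 0) (u₀ : U)
        (β : FogGame.Behaviour A U O i)
        {S : Type*} [MeasurableSpace S] (P : Measure S) [IsProbabilityMeasure P]
        (u : ℕ → S → U) (a : ℕ → S → A i) (o : ℕ → S → O) (_ : G.IsRun i β u₀ y P u a o),
      ∀ᵐ ω ∂P, ∃ q ∈ stdSimplex ℝ (OtherTypes Y i),
        Tendsto (G.typeBeliefSeq i (fun y' => (prior y').toReal) (fun t => u t ω) (fun t => a t ω))
          atTop (𝓝 q) ∧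
        Tendsto (fun t => G.typeBeliefUpdate i q (u t ω) (a t ω) (u (t + 1) ω)) atTop (𝓝 q) ∧
        ∀ w c w', (∃ᶠ t in atTop, u t ω = w ∧ a t ω = c ∧ u (t + 1) ω = w') →
          G.typeBeliefUpdate i q w c w' = q) ∧
    -- this update is the type component of the belief update used by the policy, whenever the
    -- past physical state is disclosed
    (∀ b ∈ stdSimplex ℝ (U × OtherTypes Y i), ∀ (a : A i) (o : O) (u u' : U),
      (∀ w, G.outcome i w = G.outcome i u → w = u) →
      FogGame.stateBelief (G.beliefUpdate b a (G.outcome i u) o) u' ≠ 0 →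
      FogGame.typeBelief (G.beliefUpdate b a (G.outcome i u) o) u' =
        G.typeBeliefUpdate i (FogGame.typeBelief b u) u a u') ∧
    -- the Bellman equation has one and only one bounded solution on the set of beliefs
    (∃ v : (U × OtherTypes Y i → ℝ) → ℝ, G.IsBellmanSolution γ v ∧
      ∀ v' : (U × OtherTypes Y i → ℝ) → ℝ, G.IsBellmanSolution γ v' →
        Set.EqOn v' v (stdSimplex ℝ (U × OtherTypes Y i))) ∧
    -- the maximizing policy is optimal from every initial state of belief
    (∀ v : (U × OtherTypes Y i → ℝ) → ℝ, G.IsBellmanSolution γ v →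
      (Finite (A i) → ∃ d : (U × OtherTypes Y i → ℝ) → A i, G.IsMaximizing γ v d) ∧
      ∀ d : (U × OtherTypes Y i → ℝ) → A i, G.IsMaximizing γ v d →
        ∀ b₀ : PMF (U × OtherTypes Y i),
          G.longTermReward i γ (G.beliefPolicy d fun s => (b₀ s).toReal) b₀ =
            v (fun s => (b₀ s).toReal) ∧
          ∀ π : FogGame.Policy A O Z i,
            G.longTermReward i γ π b₀ ≤
              G.longTermReward i γ (G.beliefPolicy d fun s => (b₀ s).toReal) b₀) := by
  refine ⟨fun prior y hy u₀ β S _ P _ u a o hrun => hrun.ae_exists_tendsto_typeBeliefSeq prior hy,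
    fun b hb a o u u' hu h => G.typeBelief_beliefUpdate hb.1 a o u u' hu h, ?_, fun v hv => ?_⟩
  · obtain ⟨v, hv⟩ := G.exists_isBellmanSolution hreward hγ₀ hγ₁
    exact ⟨v, hv, fun v' hv' => hv'.eqOn hγ₀ hγ₁ hv⟩
  · refine ⟨fun _ => FogGame.exists_isMaximizing γ v, fun d hd b₀ => ?_⟩
    obtain ⟨h1, h2⟩ := hv.longTermReward hγ₀ hγ₁ hreward hd b₀
    exact ⟨h1, fun π => (h2 π).trans h1.ge⟩
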